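/- Let $p$ be a prime, let $R$ be a Noetherian $\mathbf{F}_p$-algebra, and let $e$ be a positive integer. For an ideal $I$ of a ring, let $I^{[p^e]}$ denote the ideal generated by the $p^e$-th powers of the elements of $I$. For a Noetherian local $\mathbf{F}_p$-algebra $(A,\mathfrak{m})$ put \[ \lambda_e(A)=\frac{l_A(A/\mathfrak{m}^{[p^e]})}{p^{e\dim A}}, \] where $l_A$ denotes length. A Noetherian ring is called J-0 if its regular locus contains a non-empty open subset of its spectrum. A function on $\operatorname{Spec}(R)$ is called constructible if it is locally constant in the constructible topology. The ring $R$ is called locally equidimensional if, for every prime $\mathfrak{p}$ of $R$, the dimension of $R_{\mathfrak{p}}/\mathfrak{q}$ is the same for all minimal primes $\mathfrak{q}$ of $R_{\mathfrak{p}}$. (1) Let $\mathfrak{p}\in\operatorname{Spec}(R)$ be such that $R/\mathfrak{p}$ is J-0. Then there exists $g\in R$, $g\notin\mathfrak{p}$, such that $\lambda_e(R_{\mathfrak{p}})=\lambda_e(R_{\mathfrak{P}})$ for all $\mathfrak{P}\in V(\mathfrak{p})\cap D(g)$. (2) Assume that $R/\mathfrak{p}$ is J-0 for all $\mathfrak{p}\in\operatorname{Spec}(R)$.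 Then the function $\mathfrak{p}\mapsto\lambda_e(R_{\mathfrak{p}})$ on $\operatorname{Spec}(R)$ is constructible. If moreover $R$ is catenary and locally equidimensional, then this function is upper semi-continuous (for the Zariski topology). -/

import Mathlib

namespace HilbertKunz

/-- The Frobenius power `I^{[p^e]}`: the ideal generated by the `p^e`-th powers of all elements
of `I`. -/
def frobeniusPower {A : Type*} [CommRing A] (p : ℕ) (I : Ideal A) (e : ℕ) : Ideal A :=
  Ideal.span ((fun x : A => x ^ p ^ e) '' (I : Set A))

/-- The Krull dimension as a natural number. It is used below for Noetherian local rings, where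
the Krull dimension is a natural number, see `natCast_dimNat`. -/
noncomputable def dimNat (A : Type*) [CommRing A] : ℕ :=
  ((ringKrullDim A).unbotD 0).toNat

/-- `λ_e(A) = l(A / 𝔪^{[p^e]}) / p^(e * dim A)` for a Noetherian local ring `(A, 𝔪)` (here `p` is
meant to be the characteristic). The length is finite, see `length_ne_top`. -/
noncomputable def lam (p e : ℕ) (A : Type*) [CommRing A] [IsLocalRing A] : ℝ :=
  ((Module.length A (A ⧸ frobeniusPower p (IsLocalRing.maximalIdeal A) e)).toNat : ℝ) /
    (p : ℝ) ^ (e * dimNat A)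

/-- The function `𝔭 ↦ λ_e(R_𝔭)` on `Spec R`. -/
noncomputable def lamAt (p e : ℕ) (R : Type*) [CommRing R] (x : PrimeSpectrum R) : ℝ :=
  lam p e (Localization.AtPrime x.asIdeal)

/-- A Noetherian ring is J-0 if its regular locus contains a non-empty open subset of its
spectrum. -/
def IsJZero (A : Type*) [CommRing A] : Prop :=
  IsNoetherianRing A ∧ ∃ U : Set (PrimeSpectrum A), IsOpen U ∧ U.Nonempty ∧
    ∀ x ∈ U, IsRegularLocalRing (Localization.AtPrime x.asIdeal)

/-- A ring is catenary if for all primes `x ≤ y` the lengths of the chains of primes from `x` to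
`y` are bounded, and all maximal (that is, saturated) such chains have the same length. -/
def IsCatenaryRing (R : Type*) [CommRing R] : Prop :=
  ∀ x y : PrimeSpectrum R, x ≤ y →
    (∃ N : ℕ, ∀ s : LTSeries (PrimeSpectrum R), s.head = x → s.last = y → s.length ≤ N) ∧
    ∀ s t : RelSeries {(a, b) : PrimeSpectrum R × PrimeSpectrum R | a ⋖ b},
      s.head = x → s.last = y → t.head = x → t.last = y → s.length = t.length

/-- A ring is equidimensional if `dim A/𝔮` is the same for all minimal primes `𝔮` of `A`. -/
def IsEquidimensionalRing (A : Type*) [CommRing A] : Prop :=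
  ∀ q₁ ∈ minimalPrimes A, ∀ q₂ ∈ minimalPrimes A, ringKrullDim (A ⧸ q₁) = ringKrullDim (A ⧸ q₂)

/-- A ring is locally equidimensional if all its localizations at primes are equidimensional. -/
def IsLocallyEquidimensionalRing (R : Type*) [CommRing R] : Prop :=
  ∀ x : PrimeSpectrum R, IsEquidimensionalRing (Localization.AtPrime x.asIdeal)

/-- A function on `Spec R` is constructible if it is locally constant in the constructible
topology. -/
def IsConstructibleFunction {R : Type*} [CommRing R] {α : Type*} (f : PrimeSpectrum R → α) :
    Prop :=
  @IsLocallyConstant (PrimeSpectrum R) α (constructibleTopology (PrimeSpectrum R)) f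

theorem natCast_dimNat (A : Type*) [CommRing A] [IsLocalRing A] [IsNoetherianRing A] :
    ((dimNat A : ℕ) : WithBot ℕ∞) = ringKrullDim A := by
  have h1 : ringKrullDim A ≠ ⊤ := (ringKrullDim_lt_top (R := A)).ne
  have h2 : ringKrullDim A ≠ ⊥ := ringKrullDim_ne_bot
  unfold dimNat
  generalize ringKrullDim A = d at h1 h2
  induction d using WithBot.recBotCoe with
  | bot => exact absurd rfl h2
  | coe n =>
    induction n using ENat.recTopCoe with
    | top => exact absurd rfl h1
    | coe m => rfl

theorem length_ne_top (p e : ℕ) (hp : p ≠ 0) (A : Type*) [CommRing A] [IsLocalRing A]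
    [IsNoetherianRing A] :
    Module.length A (A ⧸ frobeniusPower p (IsLocalRing.maximalIdeal A) e) ≠ ⊤ := by
  set I := frobeniusPower p (IsLocalRing.maximalIdeal A) e with hI
  have hmin : IsLocalRing.maximalIdeal A ∈ I.minimalPrimes := by
    refine ⟨⟨inferInstance, ?_⟩, ?_⟩
    · rw [hI, frobeniusPower, Ideal.span_le]
      rintro _ ⟨x, hx, rfl⟩
      exact Ideal.pow_mem_of_mem _ hx _ (pow_pos (Nat.pos_of_ne_zero hp) e)
    · rintro J ⟨hJ, hle⟩ _ x hx
      exact hJ.mem_of_pow_mem (p ^ e) (hle (Ideal.subset_span ⟨x, hx, rfl⟩))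
  have hart : IsArtinianRing (A ⧸ I) :=
    IsLocalRing.quotient_artinian_of_mem_minimalPrimes_of_isLocalRing I hmin
  have : IsArtinian A (A ⧸ I) :=
    isArtinian_of_surjective_algebraMap (Ideal.Quotient.mk_surjective (I := I))
  rw [Module.length_ne_top_iff, isFiniteLength_iff_isNoetherian_isArtinian]
  exact ⟨inferInstance, this⟩

end HilbertKunz

namespace HilbertKunz

open scoped TensorProduct

universe u v w

/-! Write `Q = p^e`, and compare `λ_e` at primes `x ⊆ y` from both sides.

Growth: suppose `ht y = ht x + 1`, and put `A = R_y`, `q = xA`, `M = A/q^[Q]`. Choose `a ∈ 𝔪 \ q`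
and let `I = q + (a)`. Filtering `A/I` and applying Frobenius gives `l(A/I^[Q]) ≤ l(A/I) ·
l(A/𝔪^[Q])`. On the other side, `I^[Q] = q^[Q] + (a^Q)`, and the one-dimensional multiplicity
inequality gives `l(A/I^[Q]) ≥ l(M_q) · l(A/(q + a^Q)) ≥ l(M_q) · Q · l(A/I)`. Cancelling the finite
nonzero `l(A/I)` leaves `Q · l(M_q) ≤ l(A/𝔪^[Q])` (`pow_mul_length_le`), which after normalization
is `λ_e(R_x) ≤ λ_e(R_y)`. This iterates along chains of length `ht y - ht x`.

Generic upper bound: a prime filtration of `R/x^[Q]` involves `R/x` exactly `l(R_x/𝔪_x^[Q])` times,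
and its other factors vanish after inverting some `g ∉ x`. If `R/x` is J-0, then for `y` in an open
part of `V(x)` the maximal ideal of `R_y` is generated by `x` and lifts `s` of regular parameters of
`(R/x)_y`. Tensoring the filtration with `R_y/𝔪_y^[Q]` gives `l(R_y/𝔪_y^[Q]) ≤ l(R_x/𝔪_x^[Q]) ·
Q^#s`. Generically `ht y = ht x + #s`, so both bounds meet and `λ_e` is constant there
(`exists_lamAt_eq`).

Constancy on a neighbourhood of `x` in each `V(x)` is constructibility. In a catenary, locally
equidimensional ring every covering of primes raises the height by one, so `λ_e` is monotone under
specialization (`lamAt_mono`), and together with constructibility this gives semicontinuity. -/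

/-! ### Lengths under base change -/

theorem length_le_add_of_exact {R : Type*} [Ring R] {M₁ M₂ M₃ : Type*} [AddCommGroup M₁]
    [AddCommGroup M₂] [AddCommGroup M₃] [Module R M₁] [Module R M₂] [Module R M₃]
    (f : M₁ →ₗ[R] M₂) (g : M₂ →ₗ[R] M₃) (hg : Function.Surjective g)
    (h : ∀ x, g x = 0 → ∃ y, f y = x) :
    Module.length R M₂ ≤ Module.length R M₁ + Module.length R M₃ := by
  rw [Module.length_eq_add_of_exact (LinearMap.ker g).subtype g
    (Submodule.subtype_injective _) hg (LinearMap.exact_subtype_ker_map g)]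
  gcongr
  have hle : LinearMap.ker g ≤ LinearMap.range f := fun x hx => h x hx
  exact (Module.length_le_of_injective _ (Submodule.inclusion_injective hle)).trans
    (Module.length_le_of_surjective _ f.surjective_rangeRestrict)

/-- An arbitrary `S` preserves only right exactness, hence an inequality. For the flat `K = R_P`
there is equality (`length_baseChange_eq_add`), and this asymmetry is what lets the bound `l(S ⊗ M)
≤ l(M_P) · l(S ⊗ R/P)` pass through extensions. -/
theorem length_baseChange_le_add {R : Type u} [CommRing R] (S : Type v) [CommRing S] [Algebra R S]
    {M₁ M₂ M₃ : Type w} [AddCommGroup M₁] [AddCommGroup M₂] [AddCommGroup M₃]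
    [Module R M₁] [Module R M₂] [Module R M₃] (f : M₁ →ₗ[R] M₂) (g : M₂ →ₗ[R] M₃)
    (hg : Function.Surjective g) (h : Function.Exact f g) :
    Module.length S (S ⊗[R] M₂) ≤ Module.length S (S ⊗[R] M₁) + Module.length S (S ⊗[R] M₃) := by
  have hg' : Function.Surjective (g.baseChange S) := by
    rw [LinearMap.baseChange_eq_ltensor]; exact LinearMap.lTensor_surjective _ hg
  have h' : Function.Exact (f.baseChange S) (g.baseChange S) := by
    rw [LinearMap.baseChange_eq_ltensor, LinearMap.baseChange_eq_ltensor]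
    exact lTensor_exact S h hg
  exact length_le_add_of_exact (f.baseChange S) (g.baseChange S) hg' fun x hx => (h' x).1 hx

theorem length_baseChange_eq_add {R : Type u} [CommRing R] (S : Type v) [CommRing S] [Algebra R S]
    [Module.Flat R S] {M₁ M₂ M₃ : Type w} [AddCommGroup M₁] [AddCommGroup M₂] [AddCommGroup M₃]
    [Module R M₁] [Module R M₂] [Module R M₃] (f : M₁ →ₗ[R] M₂) (g : M₂ →ₗ[R] M₃)
    (hf : Function.Injective f) (hg : Function.Surjective g) (h : Function.Exact f g) :
    Module.length S (S ⊗[R] M₂) = Module.length S (S ⊗[R] M₁) + Module.length S (S ⊗[R] M₃) := by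
  apply Module.length_eq_add_of_exact (f.baseChange S) (g.baseChange S)
  · rw [LinearMap.baseChange_eq_ltensor]
    exact Module.Flat.lTensor_preserves_injective_linearMap _ hf
  · rw [LinearMap.baseChange_eq_ltensor]; exact LinearMap.lTensor_surjective _ hg
  · rw [LinearMap.baseChange_eq_ltensor, LinearMap.baseChange_eq_ltensor]
    exact lTensor_exact S h hg

/-- If `M` is a finite module which is killed by a power of the prime `P`, then after inverting
one element outside `P`, every base change `S ⊗ M` has length at most
`l(M_P) * l(S ⊗ R/P)`. -/
theorem exists_length_baseChange_le {R : Type u} [CommRing R] [IsNoetherianRing R] (P : Ideal R)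
    [P.IsPrime] (K : Type v) [CommRing K] [Algebra R K] [IsLocalization.AtPrime K P]
    (M : Type u) [AddCommGroup M] [Module R M] [Module.Finite R M] (N : ℕ)
    (hN : P ^ N ≤ Module.annihilator R M) :
    ∃ g ∉ P, ∀ (S : Type w) [CommRing S] [Algebra R S], IsUnit (algebraMap R S g) →
      Module.length S (S ⊗[R] M) ≤
        Module.length K (K ⊗[R] M) * Module.length S (S ⊗[R] (R ⧸ P)) := by
  have hP : P.IsPrime := inferInstance
  have hloc : IsLocalization P.primeCompl K := inferInstance
  have : Module.Flat R K := IsLocalization.flat K P.primeCompl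
  induction ‹Module.Finite R M› using
    IsNoetherianRing.induction_on_isQuotientEquivQuotientPrime R with
  | subsingleton M =>
    refine ⟨1, fun h => hP.ne_top ((Ideal.eq_top_iff_one _).2 h), fun S _ _ _ => ?_⟩
    simp [Module.length_eq_zero]
  | quotient M p' φ =>
    -- A power of `P` kills `R/p'`, so `P ⊆ p'`. If `p' = P`, the factor `l(K ⊗ M)` is at least one;
    -- otherwise an element of `p'` outside `P` becomes a unit in `S` and `S ⊗ M` vanishes.
    have hle : P ≤ p'.1 := by
      have h1 : Module.annihilator R M = p'.1 := by
        rw [φ.annihilator_eq, Ideal.annihilator_quotient]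
      exact p'.2.le_of_pow_le (h1 ▸ hN)
    by_cases h : p'.1 ≤ P
    · have hp' : p'.1 = P := le_antisymm h hle
      rw [hp'] at φ
      refine ⟨1, fun h => hP.ne_top ((Ideal.eq_top_iff_one _).2 h), fun S _ _ _ => ?_⟩
      rw [(φ.baseChange R S).length_eq, (φ.baseChange R K).length_eq]
      refine le_mul_of_one_le_left (zero_le) (Order.one_le_iff_pos.2 ?_)
      rw [Module.length_pos_iff,
        ← (Algebra.TensorProduct.quotIdealMapEquivTensorQuot K P).toEquiv.nontrivial_congr]
      have := IsLocalization.AtPrime.isLocalRing K P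
      refine Ideal.Quotient.nontrivial_iff.2 ?_
      rw [IsLocalization.AtPrime.map_eq_maximalIdeal P K]
      exact Ideal.IsPrime.ne_top'
    · obtain ⟨g, hg, hgP⟩ := Set.not_subset.1 h
      refine ⟨g, hgP, fun S _ _ hu => ?_⟩
      have : Subsingleton (S ⊗[R] M) := by
        rw [((φ.baseChange R S).toEquiv.trans
          (Algebra.TensorProduct.quotIdealMapEquivTensorQuot S p'.1).symm.toEquiv).subsingleton_congr]
        refine Ideal.Quotient.subsingleton_iff.2 ?_
        exact Ideal.eq_top_of_isUnit_mem _ (Ideal.mem_map_of_mem _ hg) hu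
      rw [Module.length_eq_zero]
      exact zero_le
  | exact M₁ M₂ M₃ f g hf hg hfg h₁ h₃ =>
    obtain ⟨g₁, hg₁, H₁⟩ := h₁ (hN.trans (f.annihilator_le_of_injective hf))
    obtain ⟨g₃, hg₃, H₃⟩ := h₃ (hN.trans (g.annihilator_le_of_surjective hg))
    refine ⟨g₁ * g₃, fun h => (hP.mem_or_mem h).elim hg₁ hg₃, fun S _ _ hu => ?_⟩
    rw [map_mul, IsUnit.mul_iff] at hu
    rw [length_baseChange_eq_add K f g hf hg hfg, add_mul]
    exact (length_baseChange_le_add S f g hg hfg).trans (add_le_add (H₁ S hu.1) (H₃ S hu.2))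

theorem length_tensor_quotient {R : Type u} [CommRing R] (S : Type v) [CommRing S] [Algebra R S]
    (I : Ideal R) :
    Module.length S (S ⊗[R] (R ⧸ I)) = Module.length S (S ⧸ I.map (algebraMap R S)) :=
  (Algebra.TensorProduct.quotIdealMapEquivTensorQuot S I).symm.toLinearEquiv.length_eq

theorem exists_length_quotient_map_le {R : Type u} [CommRing R] [IsNoetherianRing R] (P : Ideal R)
    [P.IsPrime] (K : Type v) [CommRing K] [Algebra R K] [IsLocalization.AtPrime K P]
    (I : Ideal R) (hI : P ≤ I.radical) :
    ∃ g ∉ P, ∀ (S : Type w) [CommRing S] [Algebra R S], IsUnit (algebraMap R S g) →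
      Module.length S (S ⧸ I.map (algebraMap R S)) ≤
        Module.length K (K ⧸ I.map (algebraMap R K)) *
          Module.length S (S ⧸ P.map (algebraMap R S)) := by
  obtain ⟨N, hN⟩ := Ideal.exists_pow_le_of_le_radical_of_fg hI (IsNoetherian.noetherian P)
  simpa only [length_tensor_quotient] using
    exists_length_baseChange_le P K (R ⧸ I) N (by rwa [Ideal.annihilator_quotient])

/-- If `A` is local and `I` is primary to the maximal ideal `𝔪`, then
`l(S/IS) ≤ l(A/I) * l(S/𝔪S)` for every `A`-algebra `S`. -/
theorem length_quotient_map_le_mul {A : Type u} [CommRing A] [IsNoetherianRing A] [IsLocalRing A]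
    {S : Type v} [CommRing S] (φ : A →+* S) (I : Ideal A)
    (hI : IsLocalRing.maximalIdeal A ≤ I.radical) :
    Module.length S (S ⧸ I.map φ) ≤
      Module.length A (A ⧸ I) * Module.length S (S ⧸ (IsLocalRing.maximalIdeal A).map φ) := by
  -- `A` is its own localization at the maximal ideal, so `K = A` is allowed and the element to be
  -- inverted is already a unit.
  have : IsLocalization.AtPrime A (IsLocalRing.maximalIdeal A) :=
    IsLocalization.of_le_isUnit fun x hx => by simpa using! hx
  obtain ⟨g, hg, H⟩ := exists_length_quotient_map_le (IsLocalRing.maximalIdeal A) A I hI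
  let := φ.toAlgebra
  have := H S (((IsLocalRing.notMem_maximalIdeal).1 hg).map _)
  rwa [Algebra.algebraMap_self, Ideal.map_id] at this

/-! ### Quotients by powers of elements -/

/-- If `u J ⊆ I`, then `l(A/I) ≤ l(A/(I + u)) + l(A/J)`. -/
theorem length_quotient_le_add {A : Type u} [CommRing A] (I J : Ideal A) (a : A)
    (h : ∀ x ∈ J, a * x ∈ I) :
    Module.length A (A ⧸ I) ≤
      Module.length A (A ⧸ J) + Module.length A (A ⧸ (I ⊔ Ideal.span {a})) := by
  let f : (A ⧸ J) →ₗ[A] (A ⧸ I) := Submodule.mapQ J I (LinearMap.lsmul A A a) h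
  let g : (A ⧸ I) →ₗ[A] (A ⧸ (I ⊔ Ideal.span {a})) := Submodule.factor le_sup_left
  have hg : Function.Surjective g := Submodule.factor_surjective _
  refine length_le_add_of_exact f g hg fun x hx => ?_
  obtain ⟨x, rfl⟩ := Submodule.Quotient.mk_surjective _ x
  have hx' : x ∈ I ⊔ Ideal.span {a} := (Submodule.Quotient.mk_eq_zero _).1 hx
  obtain ⟨y, hy, z, hz, rfl⟩ := Submodule.mem_sup.1 hx'
  obtain ⟨b, rfl⟩ := Ideal.mem_span_singleton'.1 hz
  refine ⟨Submodule.Quotient.mk b, ?_⟩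
  change Submodule.Quotient.mk (a * b) = _
  rw [Submodule.Quotient.eq]
  have : a * b - (y + b * a) = - y := by ring
  rw [this]
  exact I.neg_mem hy

/-- Modulo `I`, each step `(x^k)/(x^(k+1))` is generated by `x^k` and killed by `I + (x)`, so it is
a quotient of `A/(I + (x))`. -/
theorem length_quotient_sup_span_pow_le {A : Type u} [CommRing A] (I : Ideal A) (x : A) (k : ℕ) :
    Module.length A (A ⧸ (I ⊔ Ideal.span {x ^ k})) ≤
      k * Module.length A (A ⧸ (I ⊔ Ideal.span {x})) := by
  induction k with
  | zero =>
    have : Subsingleton (A ⧸ (I ⊔ Ideal.span {x ^ 0})) := by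
      rw [pow_zero, Ideal.span_singleton_one, sup_top_eq]
      infer_instance
    rw [Module.length_eq_zero]
    exact zero_le
  | succ k ih =>
    refine (length_quotient_le_add _ (I ⊔ Ideal.span {x}) (x ^ k) ?_).trans ?_
    · intro y hy
      obtain ⟨i, hi, z, hz, rfl⟩ := Submodule.mem_sup.1 hy
      obtain ⟨b, rfl⟩ := Ideal.mem_span_singleton'.1 hz
      rw [mul_add]
      refine add_mem (Ideal.mem_sup_left (I.mul_mem_left _ hi)) (Ideal.mem_sup_right ?_)
      exact Ideal.mem_span_singleton'.2 ⟨b, by ring⟩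
    · have : I ⊔ Ideal.span {x ^ (k + 1)} ⊔ Ideal.span {x ^ k} = I ⊔ Ideal.span {x ^ k} := by
        rw [sup_assoc]
        congr 1
        exact sup_eq_right.2 (Ideal.span_singleton_le_span_singleton.2 (pow_dvd_pow x k.le_succ))
      rw [this, Nat.cast_succ, add_mul, one_mul, add_comm]
      gcongr

theorem length_quotient_sup_span_image_pow_le {A : Type u} [CommRing A] (I : Ideal A)
    (s : Finset A) (k : ℕ) :
    Module.length A (A ⧸ (I ⊔ Ideal.span ((fun x => x ^ k) '' (s : Set A)))) ≤
      (k ^ s.card : ℕ) * Module.length A (A ⧸ (I ⊔ Ideal.span (s : Set A))) := by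
  classical
  induction s using Finset.induction_on generalizing I with
  | empty => rw [Finset.coe_empty, Set.image_empty, Finset.card_empty, pow_zero, Nat.cast_one,
      one_mul]
  | insert a s ha ih =>
    rw [Finset.card_insert_of_notMem ha, Finset.coe_insert, Set.image_insert_eq,
      Ideal.span_insert, Ideal.span_insert, ← sup_assoc, ← sup_assoc]
    refine (ih (I ⊔ Ideal.span {a ^ k})).trans ?_
    rw [sup_right_comm I (Ideal.span {a ^ k}), sup_right_comm I (Ideal.span {a}), pow_succ,
      Nat.cast_mul, mul_assoc]
    exact mul_le_mul_right (length_quotient_sup_span_pow_le (I ⊔ Ideal.span (s : Set A)) a k) _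

/-! ### The multiplicity inequality in dimension one -/

theorem length_ne_top_of_le_annihilator {A : Type u} [CommRing A] (I : Ideal A)
    (hI : Module.length A (A ⧸ I) ≠ ⊤) (T : Type v) [AddCommGroup T] [Module A T]
    [Module.Finite A T] (h : I ≤ Module.annihilator A T) : Module.length A T ≠ ⊤ := by
  obtain ⟨n, t, ht⟩ := Module.Finite.exists_fin (R := A) (M := T)
  let φ (i : Fin n) : (A ⧸ I) →ₗ[A] T := I.liftQ (LinearMap.toSpanSingleton A T (t i))
    fun a ha => Module.mem_annihilator.1 (h ha) (t i)
  let Φ : (Fin n → A ⧸ I) →ₗ[A] T := LinearMap.lsum A (fun _ => A ⧸ I) A φ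
  have hΦ : Function.Surjective Φ := by
    rw [← LinearMap.range_eq_top, eq_top_iff, ← ht, Submodule.span_le]
    rintro _ ⟨i, rfl⟩
    refine ⟨Pi.single i (Submodule.Quotient.mk 1), ?_⟩
    rw [LinearMap.lsum_piSingle]
    change (1 : A) • t i = t i
    rw [one_smul]
  refine ne_top_of_le_ne_top ?_ (Module.length_le_of_surjective Φ hΦ)
  rw [Module.length_pi_of_fintype]
  exact (ENat.sum_lt_top.2 fun _ _ => hI.lt_top).ne

open scoped Pointwise in
/-- For a torsion-free module `T` of rank one over the one-dimensional domain `A/q`,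
one has `l(A/(q + y)) ≤ l(T/yT)`. -/
theorem length_quotient_le_length_quotSMulTop {A : Type u} [CommRing A] (q : Ideal A)
    (hfin : ∀ s ∉ q, Module.length A (A ⧸ (q ⊔ Ideal.span {s})) ≠ ⊤)
    (T : Type v) [AddCommGroup T] [Module A T] [Module.Finite A T]
    (hann : q ≤ Module.annihilator A T) (htf : ∀ s ∉ q, ∀ t : T, s • t = 0 → t = 0)
    (t₀ : T) (ht₀ : t₀ ≠ 0) (hq : q.IsPrime) (hrk : ∀ t : T, ∃ s ∉ q, ∃ a : A, s • t = a • t₀)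
    (y : A) :
    Module.length A (A ⧸ (q ⊔ Ideal.span {y})) ≤ Module.length A (QuotSMulTop y T) := by
  set E : Submodule A T := A ∙ t₀ with hE
  -- The product of the denominators of finitely many generators is an `s ∉ q` with `sT ⊆ E`. So
  -- `T/E` is a finite module over `A/(q + (s))`, which has finite length; this finiteness allows
  -- the cancellation at the end.
  have hTE : Module.length A (T ⧸ E) ≠ ⊤ := by
    have : ∃ s ∉ q, ∀ t : T, s • t ∈ E := by
      obtain ⟨n, t, ht⟩ := Module.Finite.exists_fin (R := A) (M := T)
      choose s hs a ha using fun i => hrk (t i)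
      refine ⟨∏ i, s i, fun h => ?_, fun x => ?_⟩
      · obtain ⟨i, -, hi⟩ := (hq.prod_mem_iff).1 h
        exact hs i hi
      · have hle : (⊤ : Submodule A T) ≤ E.comap (LinearMap.lsmul A T (∏ i, s i)) := by
          rw [← ht, Submodule.span_le]
          rintro _ ⟨i, rfl⟩
          change (∏ i, s i) • t i ∈ E
          rw [← Finset.prod_erase_mul _ _ (Finset.mem_univ i), mul_smul, ha]
          exact E.smul_mem _ (E.smul_mem _ (Submodule.mem_span_singleton_self t₀))
        exact hle (Submodule.mem_top (x := x))
    obtain ⟨s, hs, hsE⟩ := this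
    refine length_ne_top_of_le_annihilator _ (hfin s hs) _ ?_
    refine sup_le (hann.trans (LinearMap.annihilator_le_of_surjective E.mkQ E.mkQ_surjective)) ?_
    rw [Ideal.span_singleton_le_iff_mem, Module.mem_annihilator]
    intro x
    obtain ⟨x, rfl⟩ := E.mkQ_surjective x
    rw [← map_smul]
    exact (Submodule.Quotient.mk_eq_zero _).2 (hsE x)
  let F : Submodule A T := y • E
  have hFE : F ≤ E := by
    rintro _ ⟨x, hx, rfl⟩
    exact E.smul_mem _ hx
  have hFT : F ≤ y • (⊤ : Submodule A T) := smul_mono_right y le_top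
  -- the sequence `0 → A/(q + y) → T/yE → T/E → 0`
  let f₁ : (A ⧸ (q ⊔ Ideal.span {y})) →ₗ[A] T ⧸ F :=
    Submodule.mapQ _ F (LinearMap.toSpanSingleton A T t₀) (by
      refine sup_le (fun a ha => ?_) ?_
      · change a • t₀ ∈ F
        rw [Module.mem_annihilator.1 (hann ha) t₀]
        exact F.zero_mem
      · rw [Submodule.span_le, Set.singleton_subset_iff]
        exact ⟨t₀, Submodule.mem_span_singleton_self t₀, rfl⟩)
  let g₁ : T ⧸ F →ₗ[A] T ⧸ E := Submodule.factor hFE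
  have hf₁ : Function.Injective f₁ := by
    rw [injective_iff_map_eq_zero]
    intro a ha
    obtain ⟨a, rfl⟩ := Submodule.Quotient.mk_surjective _ a
    have ha' : a • t₀ ∈ F := (Submodule.Quotient.mk_eq_zero _).1 ha
    obtain ⟨e, he, hea⟩ := ha'
    obtain ⟨b, rfl⟩ := Submodule.mem_span_singleton.1 he
    have hz : (a - y * b) • t₀ = 0 := by
      rw [sub_smul, mul_smul, sub_eq_zero]; exact hea.symm
    have hmem : a - y * b ∈ q := by
      by_contra hc
      exact ht₀ (htf _ hc _ hz)
    refine (Submodule.Quotient.mk_eq_zero _).2 ?_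
    rw [← sub_add_cancel a (y * b)]
    exact add_mem (Ideal.mem_sup_left hmem)
      (Ideal.mem_sup_right (Ideal.mem_span_singleton.2 (dvd_mul_right y b)))
  have h₁ : Function.Exact f₁ g₁ := by
    intro x
    obtain ⟨x, rfl⟩ := Submodule.Quotient.mk_surjective _ x
    constructor
    · intro hx
      have hx' : x ∈ E := (Submodule.Quotient.mk_eq_zero _).1 hx
      obtain ⟨b, rfl⟩ := Submodule.mem_span_singleton.1 hx'
      exact ⟨Submodule.Quotient.mk b, rfl⟩
    · rintro ⟨a, ha⟩
      obtain ⟨a, rfl⟩ := Submodule.Quotient.mk_surjective _ a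
      rw [← ha]
      refine (Submodule.Quotient.mk_eq_zero _).2 ?_
      exact E.smul_mem _ (Submodule.mem_span_singleton_self t₀)
  -- the sequence `T/E → T/yE → T/yT → 0`
  let f₂ : T ⧸ E →ₗ[A] T ⧸ F := Submodule.mapQ E F (LinearMap.lsmul A T y)
    fun x hx => ⟨x, hx, rfl⟩
  let g₂ : T ⧸ F →ₗ[A] QuotSMulTop y T := Submodule.factor hFT
  have h₂ : ∀ x, g₂ x = 0 → ∃ z, f₂ z = x := by
    intro x hx
    obtain ⟨x, rfl⟩ := Submodule.Quotient.mk_surjective _ x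
    obtain ⟨z, -, rfl⟩ : x ∈ y • (⊤ : Submodule A T) := (Submodule.Quotient.mk_eq_zero _).1 hx
    exact ⟨Submodule.Quotient.mk z, rfl⟩
  have e₁ := Module.length_eq_add_of_exact f₁ g₁ hf₁ (Submodule.factor_surjective _) h₁
  have e₂ := length_le_add_of_exact f₂ g₂ (Submodule.factor_surjective _) h₂
  rw [e₁, add_comm] at e₂
  exact (ENat.add_le_add_iff_left hTE).1 e₂

open scoped Pointwise in
/-- If `A/q` is one-dimensional and `y ∉ q`, then `l(M_q) * l(A/(q + y)) ≤ l(M/yM)`. -/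
theorem mul_length_le_length_quotSMulTop {A : Type u} [CommRing A] [IsNoetherianRing A]
    (q : Ideal A) [hq : q.IsPrime]
    (hfin : ∀ s ∉ q, Module.length A (A ⧸ (q ⊔ Ideal.span {s})) ≠ ⊤)
    (K : Type v) [CommRing K] [Algebra A K] [IsLocalization.AtPrime K q] (y : A) (hy : y ∉ q)
    (n : ℕ) (M : Type w) [AddCommGroup M] [Module A M] [Module.Finite A M]
    (M' : Type*) [AddCommGroup M'] [Module A M'] [Module K M'] [IsScalarTower A K M']
    (f : M →ₗ[A] M') [IsLocalizedModule q.primeCompl f] (hn : (n : ℕ∞) ≤ Module.length K M') :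
    (n : ℕ∞) * Module.length A (A ⧸ (q ⊔ Ideal.span {y})) ≤ Module.length A (QuotSMulTop y M) := by
  induction n generalizing M M' with
  | zero => simp
  | succ n ih =>
    have hloc : IsLocalRing K := IsLocalization.AtPrime.isLocalRing K q
    have : Module.Finite K M' := Module.Finite.of_isLocalizedModule q.primeCompl f
    have : Nontrivial M' := by
      rw [← Module.length_pos_iff (R := K)]
      exact lt_of_lt_of_le (by simp) hn
    -- Induction on the length over `K`: peel off a simple quotient `M'/N'`. The preimage `N` of
    -- `N'` localizes back to `N'`, and `M/N` is torsion-free of rank one over `A/q`.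
    obtain ⟨N', hN', -⟩ := (eq_top_or_exists_le_coatom (⊥ : Submodule K M')).resolve_left bot_ne_top
    have hsimple : IsSimpleModule K (M' ⧸ N') := isSimpleModule_iff_isCoatom.2 hN'
    set N : Submodule A M := (N'.restrictScalars A).comap f with hN
    have hlocN : N.localized' K q.primeCompl f = N' :=
      (Submodule.localized'gi K q.primeCompl f).l_u_eq N'
    have hlen : (n : ℕ∞) ≤ Module.length K (N.localized' K q.primeCompl f) := by
      rw [hlocN]
      have := Module.length_eq_add_of_exact N'.subtype N'.mkQ N'.injective_subtype
        N'.mkQ_surjective (LinearMap.exact_subtype_mkQ N')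
      rw [this, Module.length_eq_one K (M' ⧸ N')] at hn
      push_cast at hn
      exact (ENat.add_le_add_iff_right ENat.one_ne_top).1 hn
    have key := ih N _ (N.toLocalized' K q.primeCompl f) hlen
    have hunit : ∀ s ∉ q, ∀ m' : M', s • m' ∈ N' → m' ∈ N' := by
      intro s hs m' hm
      rw [← algebraMap_smul K] at hm
      exact (N'.smul_mem_iff_of_isUnit (IsLocalization.map_units K (⟨s, hs⟩ : q.primeCompl))).1 hm
    have hunitN : ∀ s ∉ q, ∀ m : M, s • m ∈ N → m ∈ N := by
      intro s hs m hm
      refine hunit s hs (f m) ?_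
      rw [← map_smul]
      exact hm
    have htf : ∀ s ∉ q, ∀ t : M ⧸ N, s • t = 0 → t = 0 := by
      intro s hs t ht
      obtain ⟨m, rfl⟩ := N.mkQ_surjective t
      rw [← map_smul] at ht
      exact (Submodule.Quotient.mk_eq_zero _).2
        (hunitN s hs m ((Submodule.Quotient.mk_eq_zero _).1 ht))
    have hreg : IsSMulRegular (M ⧸ N) y := by
      intro a b hab
      have : y • (a - b) = 0 := by rw [smul_sub, sub_eq_zero]; exact hab
      exact sub_eq_zero.1 (htf y hy _ this)
    have hex : Module.length A (QuotSMulTop y M) =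
        Module.length A (QuotSMulTop y N) + Module.length A (QuotSMulTop y (M ⧸ N)) := by
      refine Module.length_eq_add_of_exact (QuotSMulTop.map y N.subtype)
        (QuotSMulTop.map y N.mkQ) ?_ (QuotSMulTop.map_surjective _ N.mkQ_surjective)
        (QuotSMulTop.map_exact y (LinearMap.exact_subtype_mkQ N) N.mkQ_surjective)
      -- `N/yN → M/yM` is injective because `y ∉ q` is regular on `M/N`: if `ym ∈ N`, then already
      -- `m ∈ N`.
      rw [injective_iff_map_eq_zero]
      intro x hx
      obtain ⟨x, rfl⟩ := Submodule.Quotient.mk_surjective _ x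
      obtain ⟨m, -, hm⟩ : (x : M) ∈ y • (⊤ : Submodule A M) :=
        (Submodule.Quotient.mk_eq_zero _).1 hx
      have hmN : m ∈ N := hunitN y hy m (by
        have : y • m = x := hm
        rw [this]; exact x.2)
      exact (Submodule.Quotient.mk_eq_zero _).2 ⟨⟨m, hmN⟩, trivial, Subtype.ext hm⟩
    obtain ⟨m₀', hm₀'⟩ : ∃ m', m' ∉ N' := by
      by_contra! h
      exact hN'.1 (eq_top_iff.2 fun x _ => h x)
    have hfN : ∀ m, N.mkQ m ≠ 0 ↔ f m ∉ N' := fun m => by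
      rw [Ne, Submodule.mkQ_apply, Submodule.Quotient.mk_eq_zero]
      rfl
    obtain ⟨⟨m₀, s₀⟩, hm₀⟩ := IsLocalizedModule.surj q.primeCompl f m₀'
    have hm₀N : f m₀ ∉ N' := by
      rw [← hm₀]
      exact fun h => hm₀' (hunit s₀ s₀.2 m₀' h)
    have hT := length_quotient_le_length_quotSMulTop q hfin (M ⧸ N) (by
        intro a ha
        rw [Module.mem_annihilator]
        intro t
        obtain ⟨m, rfl⟩ := N.mkQ_surjective t
        rw [← map_smul]
        by_contra h
        have h1 := (hfN _).1 h
        apply h1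
        -- The annihilator of the simple module `M'/N'` is the maximal ideal of `K`, which contains
        -- the image of `q`.
        have h2 : algebraMap A K a ∈ Module.annihilator K (M' ⧸ N') := by
          rw [IsLocalRing.eq_maximalIdeal (IsSimpleModule.annihilator_isMaximal (R := K)
            (M := M' ⧸ N'))]
          exact (IsLocalization.AtPrime.to_map_mem_maximal_iff K q a).2 ha
        have h3 := Module.mem_annihilator.1 h2 (N'.mkQ (f m))
        rw [← map_smul, algebraMap_smul, ← map_smul] at h3
        exact (Submodule.Quotient.mk_eq_zero _).1 h3)
      htf (N.mkQ m₀) ((hfN m₀).2 hm₀N) hq (by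
        intro t
        obtain ⟨m, rfl⟩ := N.mkQ_surjective t
        -- Rank one: `N'` is maximal, so `f m₀` generates `M'/N'` over `K`; clearing the denominator
        -- of the coefficient gives the relation over `A`.
        have h1 : N' ⊔ (K ∙ f m₀) = ⊤ := hN'.2 _ (left_lt_sup.2 fun h =>
          hm₀N (h (Submodule.mem_span_singleton_self _)))
        have h2 : f m ∈ N' ⊔ (K ∙ f m₀) := h1 ▸ Submodule.mem_top
        obtain ⟨n', hn', z, hz, hnz⟩ := Submodule.mem_sup.1 h2
        obtain ⟨c, rfl⟩ := Submodule.mem_span_singleton.1 hz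
        obtain ⟨⟨a, s⟩, has⟩ := IsLocalization.surj q.primeCompl c
        refine ⟨s, s.2, a, ?_⟩
        rw [← map_smul, ← map_smul, ← sub_eq_zero, ← map_sub]
        refine (Submodule.Quotient.mk_eq_zero _).2 ?_
        change f ((s : A) • m - a • m₀) ∈ N'
        have h3 : f ((s : A) • m - a • m₀) = algebraMap A K s • n' := by
          rw [map_sub, map_smul, map_smul, ← hnz, ← algebraMap_smul K, ← algebraMap_smul K a,
            smul_add, smul_smul, mul_comm, has, add_sub_cancel_right]
        rw [h3]
        exact N'.smul_mem _ hn') y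
    rw [hex, Nat.cast_succ, add_mul, one_mul]
    exact add_le_add key hT

/-! ### Frobenius powers and the one-step growth of lengths -/

/-- Frobenius is a ring endomorphism, so Frobenius powers inherit from `Ideal.map` compatibility
with sums, generators and base change. -/
theorem frobeniusPower_eq_map {A : Type u} [CommRing A] (p : ℕ) [ExpChar A p] (I : Ideal A)
    (e : ℕ) : frobeniusPower p I e = I.map (iterateFrobenius A p e) := rfl

theorem frobeniusPower_map {A : Type u} [CommRing A] {K : Type v} [CommRing K] (p : ℕ)
    [ExpChar A p] [ExpChar K p] (f : A →+* K) (I : Ideal A) (e : ℕ) :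
    frobeniusPower p (I.map f) e = (frobeniusPower p I e).map f := by
  rw [frobeniusPower_eq_map, frobeniusPower_eq_map, Ideal.map_map, Ideal.map_map]
  congr 1
  ext x
  simp [iterateFrobenius_def]

theorem pow_mem_frobeniusPower {A : Type u} [CommRing A] (p : ℕ) {I : Ideal A}
    (e : ℕ) {x : A} (hx : x ∈ I) : x ^ p ^ e ∈ frobeniusPower p I e :=
  Ideal.subset_span ⟨x, hx, rfl⟩

theorem le_radical_frobeniusPower {A : Type u} [CommRing A] (p : ℕ) (I : Ideal A)
    (e : ℕ) : I ≤ (frobeniusPower p I e).radical :=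
  fun _ hx => ⟨p ^ e, pow_mem_frobeniusPower p e hx⟩

theorem length_quotient_ne_top {A : Type u} [CommRing A] [IsNoetherianRing A] [IsLocalRing A]
    (I : Ideal A) (hI : IsLocalRing.maximalIdeal A ≤ I.radical) :
    Module.length A (A ⧸ I) ≠ ⊤ := by
  by_cases hle : I ≤ IsLocalRing.maximalIdeal A
  · have hmin : IsLocalRing.maximalIdeal A ∈ I.minimalPrimes :=
      ⟨⟨inferInstance, hle⟩, fun J hJ _ => hI.trans (hJ.1.radical_le_iff.2 hJ.2)⟩
    have hart : IsArtinianRing (A ⧸ I) :=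
      IsLocalRing.quotient_artinian_of_mem_minimalPrimes_of_isLocalRing I hmin
    have : IsArtinian A (A ⧸ I) :=
      isArtinian_of_surjective_algebraMap (Ideal.Quotient.mk_surjective (I := I))
    exact Module.length_ne_top
  · have : I = ⊤ := by
      by_contra h
      exact hle (IsLocalRing.le_maximalIdeal h)
    have : Subsingleton (A ⧸ I) := Ideal.Quotient.subsingleton_iff.2 this
    rw [Module.length_eq_zero]
    exact ENat.zero_ne_top

theorem length_quotSMulTop_quotient_le {A : Type u} [CommRing A] (J : Ideal A) (y : A) :
    Module.length A (QuotSMulTop y (A ⧸ J)) ≤ Module.length A (A ⧸ (J ⊔ Ideal.span {y})) := by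
  let π : A →ₗ[A] QuotSMulTop y (A ⧸ J) := (Submodule.mkQ _).comp J.mkQ
  have hπ : Function.Surjective π := (Submodule.mkQ_surjective _).comp J.mkQ_surjective
  have hle : J ⊔ Ideal.span {y} ≤ LinearMap.ker π := by
    refine sup_le (fun a ha => ?_) ?_
    · have : J.mkQ a = 0 := (Submodule.Quotient.mk_eq_zero _).2 ha
      rw [LinearMap.mem_ker, LinearMap.comp_apply, this, map_zero]
    · rw [Ideal.span_singleton_le_iff_mem, LinearMap.mem_ker]
      refine (Submodule.Quotient.mk_eq_zero _).2 ⟨J.mkQ 1, trivial, ?_⟩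
      change y • J.mkQ 1 = _
      rw [← map_smul, smul_eq_mul, mul_one]
  refine Module.length_le_of_surjective (Submodule.liftQ _ π hle) fun z => ?_
  obtain ⟨a, rfl⟩ := hπ z
  exact ⟨Submodule.Quotient.mk a, rfl⟩

/-- Since `x` is regular modulo the prime `q`, multiplication by `x^k` embeds `A/(q + (x))` in `A/(q
+ (x^(k+1)))` with cokernel `A/(q + (x^k))`. -/
theorem mul_length_quotient_le_sup_span_pow {A : Type u} [CommRing A] (q : Ideal A)
    [hq : q.IsPrime] (x : A) (hx : x ∉ q) (k : ℕ) :
    k * Module.length A (A ⧸ (q ⊔ Ideal.span {x})) ≤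
      Module.length A (A ⧸ (q ⊔ Ideal.span {x ^ k})) := by
  induction k with
  | zero => simp
  | succ k ih =>
    have hle : q ⊔ Ideal.span {x ^ (k + 1)} ≤ q ⊔ Ideal.span {x ^ k} :=
      sup_le_sup_left (Ideal.span_singleton_le_span_singleton.2 (pow_dvd_pow x k.le_succ)) _
    let f : (A ⧸ (q ⊔ Ideal.span {x})) →ₗ[A] A ⧸ (q ⊔ Ideal.span {x ^ (k + 1)}) :=
      Submodule.mapQ _ _ (LinearMap.lsmul A A (x ^ k)) (by
        refine sup_le (fun a ha => Ideal.mem_sup_left (q.mul_mem_left _ ha)) ?_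
        rw [Ideal.span_singleton_le_iff_mem]
        exact Ideal.mem_sup_right (Ideal.mem_span_singleton.2 (by
          simp [pow_succ])))
    let g : (A ⧸ (q ⊔ Ideal.span {x ^ (k + 1)})) →ₗ[A] A ⧸ (q ⊔ Ideal.span {x ^ k}) :=
      Submodule.factor hle
    have hf : Function.Injective f := by
      rw [injective_iff_map_eq_zero]
      intro a ha
      obtain ⟨a, rfl⟩ := Submodule.Quotient.mk_surjective _ a
      have ha' : x ^ k * a ∈ q ⊔ Ideal.span {x ^ (k + 1)} := (Submodule.Quotient.mk_eq_zero _).1 ha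
      obtain ⟨i, hi, z, hz, hiz⟩ := Submodule.mem_sup.1 ha'
      obtain ⟨b, rfl⟩ := Ideal.mem_span_singleton.1 hz
      refine (Submodule.Quotient.mk_eq_zero _).2 ?_
      have h1 : x ^ k * (a - x * b) ∈ q := by
        have : x ^ k * (a - x * b) = i := by
          rw [mul_sub, ← hiz]; ring
        rwa [this]
      have h2 : a - x * b ∈ q :=
        (hq.mem_or_mem h1).resolve_left fun h => hx (hq.mem_of_pow_mem k h)
      rw [← sub_add_cancel a (x * b)]
      exact add_mem (Ideal.mem_sup_left h2)
        (Ideal.mem_sup_right (Ideal.mem_span_singleton.2 (dvd_mul_right x b)))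
    have hfg : Function.Exact f g := by
      intro a
      obtain ⟨a, rfl⟩ := Submodule.Quotient.mk_surjective _ a
      constructor
      · intro ha
        have ha' : a ∈ q ⊔ Ideal.span {x ^ k} := (Submodule.Quotient.mk_eq_zero _).1 ha
        obtain ⟨i, hi, z, hz, rfl⟩ := Submodule.mem_sup.1 ha'
        obtain ⟨b, rfl⟩ := Ideal.mem_span_singleton.1 hz
        refine ⟨Submodule.Quotient.mk b, ?_⟩
        change Submodule.Quotient.mk (x ^ k * b) = _
        rw [Submodule.Quotient.eq]
        have : x ^ k * b - (i + x ^ k * b) = - i := by ring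
        rw [this]
        exact Ideal.mem_sup_left (q.neg_mem hi)
      · rintro ⟨b, hb⟩
        obtain ⟨b, rfl⟩ := Submodule.Quotient.mk_surjective _ b
        rw [← hb]
        exact (Submodule.Quotient.mk_eq_zero _).2
          (Ideal.mem_sup_right (Ideal.mem_span_singleton.2 (dvd_mul_right (x ^ k) b)))
    rw [Module.length_eq_add_of_exact f g hf (Submodule.factor_surjective _) hfg, Nat.cast_succ,
      add_mul, one_mul, add_comm]
    exact add_le_add le_rfl ih

/-- Let `A` be local Noetherian of characteristic `p` and let `q` be a prime ideal with
`dim A/q = 1`. Then `p^e * l(A_q/(q A_q)^[p^e]) ≤ l(A/𝔪^[p^e])`. -/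
theorem pow_mul_length_le {A : Type u} [CommRing A] [IsNoetherianRing A] [IsLocalRing A] (p : ℕ)
    [hp : Fact p.Prime] [ExpChar A p] (e : ℕ) (q : Ideal A) [hq : q.IsPrime]
    (hqm : q ≠ IsLocalRing.maximalIdeal A)
    (hdim : ∀ s ∉ q, IsLocalRing.maximalIdeal A ≤ (q ⊔ Ideal.span {s}).radical)
    (K : Type v) [CommRing K] [IsLocalRing K] [ExpChar K p] [Algebra A K]
    [IsLocalization.AtPrime K q] :
    (p ^ e : ℕ) * Module.length K (K ⧸ frobeniusPower p (IsLocalRing.maximalIdeal K) e) ≤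
      Module.length A (A ⧸ frobeniusPower p (IsLocalRing.maximalIdeal A) e) := by
  have : IsNoetherianRing K := IsLocalization.isNoetherianRing q.primeCompl K inferInstance
  have hfin (s) (hs : s ∉ q) := length_quotient_ne_top _ (hdim s hs)
  obtain ⟨x, hxm, hxq⟩ : ∃ x ∈ IsLocalRing.maximalIdeal A, x ∉ q := by
    by_contra! h
    exact hqm (le_antisymm (IsLocalRing.le_maximalIdeal hq.ne_top) h)
  set Q := p ^ e with hQ
  have hyq : x ^ Q ∉ q := fun h => hxq (hq.mem_of_pow_mem _ h)
  set I := q ⊔ Ideal.span {x} with hI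
  set J := frobeniusPower p q e with hJ
  -- The local length bound is applied to Frobenius itself as the map `A → A`; no flatness is
  -- involved.
  have h1 : Module.length A (A ⧸ frobeniusPower p I e) ≤ _ :=
    length_quotient_map_le_mul (iterateFrobenius A p e) I (hdim x hxq)
  have h2 : frobeniusPower p I e = J ⊔ Ideal.span {x ^ Q} := by
    rw [frobeniusPower_eq_map, hI, Ideal.map_sup, Ideal.map_span, Set.image_singleton,
      ← frobeniusPower_eq_map, iterateFrobenius_def]
  have h3 : Module.length K (K ⧸ frobeniusPower p (IsLocalRing.maximalIdeal K) e) =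
      Module.length K (K ⊗[A] (A ⧸ J)) := by
    rw [length_tensor_quotient, hJ, ← frobeniusPower_map,
      IsLocalization.AtPrime.map_eq_maximalIdeal q K]
  have h4 := length_ne_top p e hp.out.ne_zero K
  rw [h3] at h4 ⊢
  have : IsLocalizedModule q.primeCompl (TensorProduct.mk A K (A ⧸ J) 1) :=
    (isLocalizedModule_iff_isBaseChange q.primeCompl K _).2 (TensorProduct.isBaseChange A _ K)
  have h5 := mul_length_le_length_quotSMulTop q hfin K (x ^ Q) hyq _ (A ⧸ J) (K ⊗[A] (A ⧸ J))
    (TensorProduct.mk A K (A ⧸ J) 1) (ENat.natCast_toNat h4).le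
  rw [ENat.natCast_toNat h4] at h5
  have h6 := h5.trans ((length_quotSMulTop_quotient_le J (x ^ Q)).trans (h2 ▸ h1))
  have h7 := (mul_le_mul_right (mul_length_quotient_le_sup_span_pow q x hxq Q) _).trans h6
  have h8 : Module.length A (A ⧸ I) ≠ 0 := by
    rw [Ne, Module.length_eq_zero_iff, Ideal.Quotient.subsingleton_iff]
    intro h
    exact (IsLocalRing.maximalIdeal.isMaximal A).ne_top (top_le_iff.1 (h ▸ sup_le
      (IsLocalRing.le_maximalIdeal hq.ne_top) ((Ideal.span_singleton_le_iff_mem _).2 hxm)))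
  -- Both sides now carry the factor `l(A/I)`, which is nonzero and finite.
  rw [mul_left_comm, ← mul_assoc, mul_comm] at h7
  exact (ENat.mul_le_mul_left_iff h8 (hfin x hxq)).1 h7

theorem expChar_of_algebra_zmod (p : ℕ) [hp : Fact p.Prime] (A : Type u) [CommRing A]
    [Nontrivial A] [Algebra (ZMod p) A] : ExpChar A p := by
  have h : (p : A) = 0 := by
    rw [← map_natCast (algebraMap (ZMod p) A) p, CharP.cast_eq_zero, map_zero]
  have := (CharP.charP_iff_prime_eq_zero (R := A) hp.out).2 h
  exact ExpChar.prime hp.out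

/-! ### Heights and chains in the spectrum -/

section Spectrum

variable {R : Type u} [CommRing R]

/-- The height of a point of the spectrum, i.e. the dimension of the local ring. -/
noncomputable def pointHeight (x : PrimeSpectrum R) : ℕ :=
  dimNat (Localization.AtPrime x.asIdeal)

variable [IsNoetherianRing R]

theorem natCast_pointHeight' (x : PrimeSpectrum R) : (pointHeight x : ℕ∞) = x.asIdeal.height := by
  have := natCast_dimNat (Localization.AtPrime x.asIdeal)
  rw [IsLocalization.AtPrime.ringKrullDim_eq_height x.asIdeal] at this
  exact_mod_cast this

theorem natCast_pointHeight (x : PrimeSpectrum R) : (pointHeight x : ℕ∞) = Order.height x := by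
  rw [natCast_pointHeight', PrimeSpectrum.height_eq_orderHeight]

theorem pointHeight_strictMono : StrictMono (pointHeight (R := R)) := by
  intro x y hxy
  have := Order.height_add_one_le hxy
  rw [← natCast_pointHeight, ← natCast_pointHeight] at this
  exact_mod_cast this

theorem wellFoundedLT_primeSpectrum : WellFoundedLT (PrimeSpectrum R) :=
  ⟨Subrelation.wf (fun h => pointHeight_strictMono h)
    (InvImage.wf pointHeight (wellFounded_lt (α := ℕ)))⟩

theorem wellFoundedGT_primeSpectrum : WellFoundedGT (PrimeSpectrum R) :=
  ⟨Subrelation.wf (fun {x y} h => (h : x.asIdeal > y.asIdeal))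
    (InvImage.wf PrimeSpectrum.asIdeal (wellFounded_gt (α := Ideal R)))⟩

theorem pointHeight_head_add_length_le (s : LTSeries (PrimeSpectrum R)) :
    pointHeight s.head + s.length ≤ pointHeight s.last := by
  induction s using RelSeries.inductionOn with
  | singleton x => simp
  | cons s x hx ih =>
    have := pointHeight_strictMono hx
    rw [RelSeries.head_cons, RelSeries.last_cons, RelSeries.cons_length]
    omega

end Spectrum

/-! ### Growth under specialization -/

/-- Localizing `R_y` further at the prime `x R_y` gives `R_x`. -/
theorem isLocalization_atPrime_map {R : Type u} [CommRing R] (x y : Ideal R) [x.IsPrime]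
    [y.IsPrime] (hxy : x ≤ y) (A : Type v) [CommRing A] [Algebra R A] [IsLocalization.AtPrime A y]
    (K : Type w) [CommRing K] [Algebra R K] [IsLocalization.AtPrime K x] [Algebra A K]
    [IsScalarTower R A K] [(x.map (algebraMap R A)).IsPrime] :
    IsLocalization.AtPrime K (x.map (algebraMap R A)) := by
  have hle : y.primeCompl ≤ x.primeCompl := fun a ha h => ha (hxy h)
  have := IsLocalization.isLocalization_of_submonoid_le A K y.primeCompl x.primeCompl hle
  refine IsLocalization.of_le (x.primeCompl.map (algebraMap R A)) _ ?_ ?_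
  · rintro _ ⟨a, ha, rfl⟩ h
    refine ha ?_
    rw [← Ideal.under_map_of_isLocalizationAtPrime y (S := A) hxy]
    exact h
  · intro a ha
    obtain ⟨⟨r, s⟩, hrs⟩ := IsLocalization.surj y.primeCompl a
    have hr : r ∉ x := fun hr => by
      have h1 : a * algebraMap R A s ∈ x.map (algebraMap R A) := by
        rw [hrs]; exact Ideal.mem_map_of_mem _ hr
      exact ha ((Ideal.mul_unit_mem_iff_mem _ (IsLocalization.map_units A s)).1 h1)
    have hu : IsUnit (algebraMap A K (a * algebraMap R A s)) := by
      rw [hrs, ← IsScalarTower.algebraMap_apply]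
      exact IsLocalization.map_units K (⟨r, hr⟩ : x.primeCompl)
    rw [map_mul] at hu
    exact isUnit_of_mul_isUnit_left hu

theorem lamAt_le_of_pointHeight_eq_add_one {R : Type u} [CommRing R] [IsNoetherianRing R] (p : ℕ)
    [hp : Fact p.Prime] [Algebra (ZMod p) R] (e : ℕ) {x y : PrimeSpectrum R} (hxy : x < y)
    (h : pointHeight y = pointHeight x + 1) : lamAt p e R x ≤ lamAt p e R y := by
  let A := Localization.AtPrime y.asIdeal
  let K := Localization.AtPrime x.asIdeal
  have hle : x.asIdeal ≤ y.asIdeal := hxy.le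
  let : Algebra A K := IsLocalization.localizationAlgebraOfSubmonoidLe A K y.asIdeal.primeCompl
    x.asIdeal.primeCompl fun a ha h => ha (hle h)
  have : IsScalarTower R A K := IsLocalization.localization_isScalarTower_of_submonoid_le A K
    y.asIdeal.primeCompl x.asIdeal.primeCompl fun a ha h => ha (hle h)
  let q := x.asIdeal.map (algebraMap R A)
  have hq : q.IsPrime := Ideal.isPrime_map_of_isLocalizationAtPrime y.asIdeal hle
  have hqx : q.under R = x.asIdeal := Ideal.under_map_of_isLocalizationAtPrime y.asIdeal hle
  have : IsLocalization.AtPrime K q := isLocalization_atPrime_map x.asIdeal y.asIdeal hle A K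
  have : ExpChar A p := expChar_of_algebra_zmod p A
  have : ExpChar K p := expChar_of_algebra_zmod p K
  have hym : y.asIdeal.map (algebraMap R A) = IsLocalRing.maximalIdeal A :=
    IsLocalization.AtPrime.map_eq_maximalIdeal y.asIdeal A
  have hqm : q ≠ IsLocalRing.maximalIdeal A := by
    intro hc
    refine hxy.ne (PrimeSpectrum.ext ?_)
    rw [← hqx, hc, ← hym]
    exact Ideal.under_map_of_isLocalizationAtPrime y.asIdeal le_rfl
  -- A prime of `R_y` containing `q` and `s` comes from some `z` with `x < z ≤ y`. As the heights of
  -- `x` and `y` differ by one, `z = y`.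
  have hdim : ∀ s ∉ q, IsLocalRing.maximalIdeal A ≤ (q ⊔ Ideal.span {s}).radical := by
    intro s hs
    rw [Ideal.radical_eq_sInf, le_sInf_iff]
    rintro P ⟨hP, hPprime⟩
    let z : PrimeSpectrum R := ⟨P.under R, inferInstance⟩
    have hzP : z.asIdeal.map (algebraMap R A) = P :=
      IsLocalization.map_under y.asIdeal.primeCompl A P
    have hxz : x < z := by
      refine lt_of_le_of_ne ?_ ?_
      · change x.asIdeal ≤ P.under R
        rw [← hqx]
        exact Ideal.comap_mono (le_sup_left.trans hP)
      · intro hxz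
        apply hs
        change s ∈ Ideal.map (algebraMap R A) x.asIdeal
        rw [hxz, hzP]
        exact hP (Ideal.mem_sup_right (Ideal.mem_span_singleton_self s))
    have hzy : z ≤ y := by
      change P.under R ≤ y.asIdeal
      refine le_of_le_of_eq (Ideal.comap_mono (IsLocalRing.le_maximalIdeal hPprime.ne_top)) ?_
      rw [← hym]
      exact Ideal.under_map_of_isLocalizationAtPrime y.asIdeal le_rfl
    have hzy' : z = y := by
      by_contra hne
      have h1 := pointHeight_strictMono hxz
      have h2 := pointHeight_strictMono (lt_of_le_of_ne hzy hne)
      omega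
    rw [← hzP, hzy', hym]
  have key := pow_mul_length_le p e q hqm hdim K
  rw [← ENat.natCast_toNat (length_ne_top p e hp.out.ne_zero K),
    ← ENat.natCast_toNat (length_ne_top p e hp.out.ne_zero A)] at key
  have key' : ((p : ℝ) ^ e) * ((Module.length K
      (K ⧸ frobeniusPower p (IsLocalRing.maximalIdeal K) e)).toNat : ℝ) ≤
      (Module.length A (A ⧸ frobeniusPower p (IsLocalRing.maximalIdeal A) e)).toNat := by
    exact_mod_cast key
  have hp0 : (0 : ℝ) < p := by exact_mod_cast hp.out.pos
  change _ / (p : ℝ) ^ (e * pointHeight x) ≤ _ / (p : ℝ) ^ (e * pointHeight y)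
  rw [div_le_div_iff₀ (by positivity) (by positivity), h, mul_add, mul_one, pow_add, mul_comm _
    ((p : ℝ) ^ e), ← mul_assoc]
  gcongr
  rw [mul_comm]
  exact key'

/-- Every step of a chain raises the height by at least one, so the equality of totals forces each
step to raise it by exactly one. -/
theorem lamAt_head_le_lamAt_last {R : Type u} [CommRing R] [IsNoetherianRing R] (p : ℕ)
    [Fact p.Prime] [Algebra (ZMod p) R] (e : ℕ) (s : LTSeries (PrimeSpectrum R))
    (h : pointHeight s.last = pointHeight s.head + s.length) :
    lamAt p e R s.head ≤ lamAt p e R s.last := by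
  induction s using RelSeries.inductionOn with
  | singleton x => exact le_rfl
  | cons s x hx ih =>
    have h1 : pointHeight x < pointHeight s.head := pointHeight_strictMono hx
    have h2 := pointHeight_head_add_length_le s
    rw [RelSeries.head_cons, RelSeries.last_cons, RelSeries.cons_length] at h
    rw [RelSeries.head_cons, RelSeries.last_cons]
    exact (lamAt_le_of_pointHeight_eq_add_one p e hx (by omega)).trans (ih (by omega))

/-- If `R_x` is equidimensional, then every minimal prime below `x` is the start of a chain
of length `ht x` ending in `x`. -/
theorem exists_ltSeries_length_eq_pointHeight {R : Type u} [CommRing R] [IsNoetherianRing R]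
    {q x : PrimeSpectrum R} (hx : IsEquidimensionalRing (Localization.AtPrime x.asIdeal))
    (hq : q.asIdeal ∈ minimalPrimes R) (hqx : q ≤ x) :
    ∃ s : LTSeries (PrimeSpectrum R), s.head = q ∧ s.last = x ∧ s.length = pointHeight x := by
  let A := Localization.AtPrime x.asIdeal
  let qA := q.asIdeal.map (algebraMap R A)
  have hqprime : qA.IsPrime := Ideal.isPrime_map_of_isLocalizationAtPrime x.asIdeal hqx
  have hqu : qA.under R = q.asIdeal := Ideal.under_map_of_isLocalizationAtPrime x.asIdeal hqx
  have hqA : qA ∈ minimalPrimes A := by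
    have h := IsLocalization.minimalPrimes_map x.asIdeal.primeCompl A (⊥ : Ideal R)
    rw [Ideal.map_bot] at h
    change qA ∈ (⊥ : Ideal A).minimalPrimes
    rw [h, Set.mem_preimage, hqu]
    exact hq
  obtain ⟨s, hs⟩ : ∃ s : LTSeries (PrimeSpectrum A), s.length = pointHeight x :=
    Order.le_krullDim_iff.1 (natCast_dimNat A).le
  -- A longest chain in `R_x` lies above some minimal prime `q'`, so `dim R_x/q' ≥ ht x`.
  -- Equidimensionality transfers this bound to the given minimal prime.
  obtain ⟨q', hq', hq's⟩ := Ideal.exists_minimalPrimes_le (I := ⊥) (J := s.head.asIdeal) bot_le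
  have h1 : (pointHeight x : WithBot ℕ∞) ≤ ringKrullDim (A ⧸ q') := by
    rw [ringKrullDim_quotient]
    refine Order.le_krullDim_iff.2 ⟨⟨s.length, fun i => ⟨s i, ?_⟩, fun i => s.step i⟩, hs⟩
    exact hq's.trans (show s.head ≤ s i from s.head_le i)
  rw [hx q' hq' qA hqA, ringKrullDim_quotient] at h1
  obtain ⟨t, ht⟩ := Order.le_krullDim_iff.1 h1
  have hmono : StrictMono (fun z : PrimeSpectrum.zeroLocus (qA : Set A) =>
      PrimeSpectrum.comap (algebraMap R A) z.1) := by
    intro a b hab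
    refine lt_of_le_of_ne (fun c hc => (show a.1 ≤ b.1 from hab.le) hc) fun h => hab.ne ?_
    exact Subtype.ext (PrimeSpectrum.localization_comap_injective A x.asIdeal.primeCompl h)
  let t' := t.map _ hmono
  have ht' : t'.length = pointHeight x := ht
  have hhead : q ≤ t'.head := by
    change q.asIdeal ≤ Ideal.comap (algebraMap R A) t.head.1.asIdeal
    rw [← hqu]
    exact Ideal.comap_mono t.head.2
  have hlast : t'.last ≤ x := by
    change Ideal.comap (algebraMap R A) t.last.1.asIdeal ≤ x.asIdeal
    refine le_of_le_of_eq (Ideal.comap_mono (IsLocalRing.le_maximalIdeal t.last.1.2.ne_top)) ?_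
    rw [← IsLocalization.AtPrime.map_eq_maximalIdeal x.asIdeal A]
    exact Ideal.under_map_of_isLocalizationAtPrime x.asIdeal le_rfl
  -- A chain of length `ht x` lying between `q` and `x` leaves no room for slack in the heights at
  -- either end.
  have h2 := pointHeight_head_add_length_le t'
  refine ⟨t', ?_, ?_, ht'⟩
  · by_contra hne
    have h3 := pointHeight_strictMono (lt_of_le_of_ne hhead (Ne.symm hne))
    have h4 := pointHeight_strictMono.monotone hlast
    omega
  · by_contra hne
    have h4 := pointHeight_strictMono (lt_of_le_of_ne hlast hne)
    omega

theorem exists_relSeries_covBy_length_eq_pointHeight {R : Type u} [CommRing R]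
    [IsNoetherianRing R] {q x : PrimeSpectrum R}
    (hx : IsEquidimensionalRing (Localization.AtPrime x.asIdeal))
    (hq : q.asIdeal ∈ minimalPrimes R) (hqx : q ≤ x) :
    ∃ s : RelSeries {(a, b) : PrimeSpectrum R × PrimeSpectrum R | a ⋖ b},
      s.head = q ∧ s.last = x ∧ s.length = pointHeight x := by
  have := wellFoundedLT_primeSpectrum (R := R)
  have := wellFoundedGT_primeSpectrum (R := R)
  obtain ⟨s, hs₁, hs₂, hs₃⟩ := exists_ltSeries_length_eq_pointHeight hx hq hqx
  obtain ⟨t, i, hti, hi₁, hi₂⟩ := s.exists_relSeries_covBy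
  have ht₁ : t.head = q := by
    rw [← hs₁]; change t.toFun 0 = s.toFun 0; rw [← hi₁, ← hti]; rfl
  have ht₂ : t.last = x := by
    rw [← hs₂]; change t.toFun (Fin.last _) = s.toFun (Fin.last _); rw [← hi₂, ← hti]; rfl
  refine ⟨t, ht₁, ht₂, le_antisymm ?_ ?_⟩
  · let t' : LTSeries (PrimeSpectrum R) := ⟨t.length, t.toFun, fun j => (t.step j).lt⟩
    have h := pointHeight_head_add_length_le t'
    have h1 : t'.last = x := ht₂
    rw [h1] at h
    exact (Nat.le_add_left _ _).trans h
  · have := Fintype.card_le_of_embedding i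
    rw [Fintype.card_fin, Fintype.card_fin] at this
    omega

theorem pointHeight_eq_add_one_of_covBy {R : Type u} [CommRing R] [IsNoetherianRing R]
    (hcat : IsCatenaryRing R) (heq : IsLocallyEquidimensionalRing R) {x y : PrimeSpectrum R}
    (hxy : x ⋖ y) : pointHeight y = pointHeight x + 1 := by
  obtain ⟨q, hq, hqx⟩ := Ideal.exists_minimalPrimes_le (I := ⊥) (J := x.asIdeal) bot_le
  let q' : PrimeSpectrum R := ⟨q, hq.1.1⟩
  have hqx' : q' ≤ x := hqx
  obtain ⟨s, hs₁, hs₂, hs₃⟩ := exists_relSeries_covBy_length_eq_pointHeight (heq x) hq hqx'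
  obtain ⟨t, ht₁, ht₂, ht₃⟩ :=
    exists_relSeries_covBy_length_eq_pointHeight (heq y) hq (hqx'.trans hxy.le)
  -- Two saturated chains from `q'` to `y` are compared: one of length `ht y`, the other of length
  -- `ht x` prolonged by the covering `x ⋖ y`.
  have := (hcat q' y (hqx'.trans hxy.le)).2 t (s.snoc y (hs₂ ▸ hxy)) ht₁ ht₂
    (by rw [RelSeries.head_snoc, hs₁]) (RelSeries.last_snoc _ _ _)
  rw [RelSeries.snoc_length] at this
  omega

theorem lamAt_mono {R : Type u} [CommRing R] [IsNoetherianRing R] (p : ℕ)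
    [Fact p.Prime] [Algebra (ZMod p) R] (e : ℕ) (hcat : IsCatenaryRing R)
    (heq : IsLocallyEquidimensionalRing R) : Monotone (lamAt p e R) := by
  have := wellFoundedLT_primeSpectrum (R := R)
  have := wellFoundedGT_primeSpectrum (R := R)
  intro x y hxy
  induction y using WellFoundedLT.induction with
  | ind y ih =>
    rcases hxy.eq_or_lt with rfl | hlt
    · exact le_rfl
    · obtain ⟨z, hxz, hzy⟩ := exists_le_covBy_of_lt hlt
      exact (ih z hzy.lt hxz).trans (lamAt_le_of_pointHeight_eq_add_one p e hzy.lt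
        (pointHeight_eq_add_one_of_covBy hcat heq hzy))

/-! ### Generic bounds near a prime -/

theorem exists_notMem_forall_mem_of_finite {R : Type u} [CommRing R] {S : Set (Ideal R)}
    (hS : S.Finite) (P : Ideal R) [hP : P.IsPrime] (h : ∀ I ∈ S, ¬ I ≤ P) :
    ∃ g ∉ P, ∀ I ∈ S, g ∈ I := by
  have : ¬ hS.toFinset.inf id ≤ P := fun hle => by
    obtain ⟨I, hI, hIP⟩ := (hP.inf_le').1 hle
    exact h I (hS.mem_toFinset.1 hI) hIP
  obtain ⟨g, hg, hgP⟩ := Set.not_subset.1 this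
  exact ⟨g, hgP, fun I hI => (Finset.inf_le (f := id) (hS.mem_toFinset.2 hI) :) hg⟩

/-- A chain of the expected length between `x` and `y` forces `λ_e` to grow from `x` to `y`. -/
theorem lamAt_le_of_ltSeries {R : Type u} [CommRing R] [IsNoetherianRing R] (p : ℕ)
    [Fact p.Prime] [Algebra (ZMod p) R] (e : ℕ) {x y : PrimeSpectrum R}
    (s : LTSeries (PrimeSpectrum R)) (hx : x ≤ s.head) (hy : s.last ≤ y)
    (h : pointHeight y ≤ pointHeight x + s.length) :
    lamAt p e R x ≤ lamAt p e R y ∧ pointHeight y = pointHeight x + s.length := by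
  have h1 := pointHeight_head_add_length_le s
  have h2 := pointHeight_strictMono.monotone hx
  have h3 := pointHeight_strictMono.monotone hy
  have hx' : s.head = x := by
    by_contra hne
    have := pointHeight_strictMono (lt_of_le_of_ne hx (Ne.symm hne))
    omega
  have hy' : s.last = y := by
    by_contra hne
    have := pointHeight_strictMono (lt_of_le_of_ne hy hne)
    omega
  have h4 := lamAt_head_le_lamAt_last p e s (by omega)
  rw [hx', hy'] at h4
  exact ⟨h4, by omega⟩

/-- After inverting one element outside `x`, the dimension formula
`ht y ≤ ht x + #s` holds whenever the maximal ideal of `R_y` is generated by `x` and `s`. -/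
theorem exists_pointHeight_le_add_card {R : Type u} [CommRing R] [IsNoetherianRing R]
    (x : PrimeSpectrum R) :
    ∃ g ∉ x.asIdeal, ∀ y : PrimeSpectrum R, x ≤ y → g ∉ y.asIdeal →
      ∀ s : Finset (Localization.AtPrime y.asIdeal),
        IsLocalRing.maximalIdeal (Localization.AtPrime y.asIdeal) =
          x.asIdeal.map (algebraMap R (Localization.AtPrime y.asIdeal)) ⊔ Ideal.span (s : Set _) →
        pointHeight y ≤ pointHeight x + s.card := by
  classical
  obtain ⟨F, hF, hFcard⟩ := x.asIdeal.exists_finset_card_eq_height_of_isNoetherianRing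
  rw [← natCast_pointHeight', Nat.cast_inj] at hFcard
  have hfin := (Ideal.span (F : Set R)).finite_minimalPrimes_of_isNoetherianRing
  -- `x` is minimal over the ideal generated by the `ht x` elements of `F`. Choosing `g` in all the
  -- other minimal primes makes `x` the only one below any `y` that avoids `g`; Krull's height
  -- theorem then applies to `F` and `s` in `R_y`.
  obtain ⟨g, hg, H⟩ := exists_notMem_forall_mem_of_finite (hfin.sdiff (t := {x.asIdeal})) x.asIdeal
    (fun I hI hle => hI.2 (le_antisymm hle (hF.2 hI.1.1 hle)))
  refine ⟨g, hg, fun y hxy hgy s hs => ?_⟩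
  let A := Localization.AtPrime y.asIdeal
  have hmin : IsLocalRing.maximalIdeal A ∈
      (Ideal.span ((F.image (algebraMap R A) ∪ s : Finset A) : Set A)).minimalPrimes := by
    refine ⟨⟨inferInstance, ?_⟩, ?_⟩
    · rw [Finset.coe_union, Finset.coe_image, Ideal.span_union, ← Ideal.map_span, hs]
      exact sup_le_sup_right (Ideal.map_mono hF.1.2) _
    · rintro P ⟨hP, hle⟩ -
      rw [Finset.coe_union, Finset.coe_image, Ideal.span_union, ← Ideal.map_span, sup_le_iff] at hle
      rw [hs]
      refine sup_le ?_ hle.2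
      rw [Ideal.map_le_iff_le_comap]
      obtain ⟨P', hP', hP'le⟩ := Ideal.exists_minimalPrimes_le (J := P.comap (algebraMap R A))
        (Ideal.map_le_iff_le_comap.1 hle.1)
      by_cases hx : P' = x.asIdeal
      · rwa [← hx]
      · refine absurd ?_ hgy
        have h1 : algebraMap R A g ∈ IsLocalRing.maximalIdeal A :=
          IsLocalRing.le_maximalIdeal hP.ne_top (hP'le (H P' ⟨hP', hx⟩))
        exact (IsLocalization.AtPrime.to_map_mem_maximal_iff A y.asIdeal g).1 h1
  have h := Ideal.height_le_card_of_mem_minimalPrimes_span_finset hmin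
  have h2 : (IsLocalRing.maximalIdeal A).height = pointHeight y := by
    have h3 := natCast_dimNat A
    rw [← IsLocalRing.maximalIdeal_height_eq_ringKrullDim] at h3
    exact_mod_cast h3.symm
  rw [h2, Nat.cast_le] at h
  refine h.trans ((Finset.card_union_le _ _).trans ?_)
  gcongr
  exact Finset.card_image_le.trans hFcard.le

/-- `R_y → (R/I)_{y/I}` is surjective with kernel `I R_y`. -/
theorem localRingHom_quotient_surjective_ker {R : Type u} [CommRing R] (I y : Ideal R)
    [I.IsPrime] [y.IsPrime] (z : Ideal (R ⧸ I)) [z.IsPrime]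
    (hz : y = z.comap (Ideal.Quotient.mk I)) :
    Function.Surjective (Localization.localRingHom y z (Ideal.Quotient.mk I) hz) ∧
      RingHom.ker (Localization.localRingHom y z (Ideal.Quotient.mk I) hz) ≤
        I.map (algebraMap R (Localization.AtPrime y)) := by
  constructor
  · intro a
    obtain ⟨r, s, rfl⟩ := IsLocalization.exists_mk'_eq z.primeCompl a
    obtain ⟨r, rfl⟩ := Ideal.Quotient.mk_surjective r
    obtain ⟨s, hs⟩ := s
    obtain ⟨s, rfl⟩ := Ideal.Quotient.mk_surjective s
    have hs' : s ∈ y.primeCompl := fun h => hs (by rw [hz] at h; exact h)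
    exact ⟨IsLocalization.mk' _ r ⟨s, hs'⟩, Localization.localRingHom_mk' _ _ _ hz r ⟨s, hs'⟩⟩
  · intro a ha
    obtain ⟨r, s, rfl⟩ := IsLocalization.exists_mk'_eq y.primeCompl a
    rw [RingHom.mem_ker, Localization.localRingHom_mk', IsLocalization.mk'_eq_zero_iff] at ha
    obtain ⟨⟨t, ht⟩, htr⟩ := ha
    have hr : Ideal.Quotient.mk I r = 0 :=
      (mul_eq_zero.1 htr).resolve_left fun h => ht (by
        change t = 0 at h
        rw [h]; exact z.zero_mem)
    rw [Ideal.Quotient.eq_zero_iff_mem] at hr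
    rw [IsLocalization.mk'_eq_mul_mk'_one]
    exact Ideal.mul_mem_right _ _ (Ideal.mem_map_of_mem _ hr)

/-- If `R/x` is J-0, then for `y` in a non-empty open subset of `V(x)` the maximal ideal of `R_y`
is generated by `x` together with `d` elements, where `d` is the length of a chain
from `x` to `y`. -/
theorem exists_maximalIdeal_eq_sup_span {R : Type u} [CommRing R]
    (x : PrimeSpectrum R) (hJ : IsJZero (R ⧸ x.asIdeal)) :
    ∃ g ∉ x.asIdeal, ∀ y : PrimeSpectrum R, x ≤ y → g ∉ y.asIdeal →
      ∃ s : Finset (Localization.AtPrime y.asIdeal),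
        IsLocalRing.maximalIdeal (Localization.AtPrime y.asIdeal) =
          x.asIdeal.map (algebraMap R (Localization.AtPrime y.asIdeal)) ⊔ Ideal.span (s : Set _) ∧
        ∃ t : LTSeries (PrimeSpectrum R), x ≤ t.head ∧ t.last ≤ y ∧ t.length = s.card := by
  classical
  obtain ⟨-, U, hU, ⟨z₀, hz₀⟩, hreg⟩ := hJ
  obtain ⟨_, ⟨f, rfl⟩, hzf, hfU⟩ :=
    PrimeSpectrum.isTopologicalBasis_basic_opens.exists_subset_of_mem_open hz₀ hU
  obtain ⟨g, rfl⟩ := Ideal.Quotient.mk_surjective f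
  refine ⟨g, fun hg => hzf ?_, fun y hxy hgy => ?_⟩
  · rw [Ideal.Quotient.eq_zero_iff_mem.2 hg]
    exact z₀.asIdeal.zero_mem
  obtain ⟨z, hz⟩ : ∃ z : PrimeSpectrum (R ⧸ x.asIdeal),
      y.asIdeal = z.asIdeal.comap (Ideal.Quotient.mk x.asIdeal) := by
    refine ⟨⟨y.asIdeal.map (Ideal.Quotient.mk x.asIdeal),
      Ideal.isPrime_map_quotientMk_of_isPrime hxy⟩, ?_⟩
    rw [Ideal.comap_map_of_surjective' _ Ideal.Quotient.mk_surjective, Ideal.mk_ker]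
    exact (sup_eq_left.2 hxy).symm
  let A := Localization.AtPrime y.asIdeal
  let B := Localization.AtPrime z.asIdeal
  have hB : IsRegularLocalRing B := hreg z (hfU fun h => hgy (by rw [hz]; exact h))
  let φ : A →+* B := Localization.localRingHom y.asIdeal z.asIdeal
    (Ideal.Quotient.mk x.asIdeal) hz
  obtain ⟨hφ, hker⟩ := localRingHom_quotient_surjective_ker x.asIdeal y.asIdeal z.asIdeal hz
  have hfg : Submodule.FG (IsLocalRing.maximalIdeal B) := IsNoetherian.noetherian _
  set G := (IsLocalRing.maximalIdeal B).generators with hG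
  have hGfin : G.Finite := hfg.finite_generators
  -- Lifts of a minimal generating set of the maximal ideal of `(R/x)_y`; by regularity their number
  -- is the dimension of that ring, which supplies the chain.
  let s : Finset A := hGfin.toFinset.image (Function.surjInv hφ)
  have hφs : φ '' (s : Set A) = G := by
    rw [Finset.coe_image, Set.image_image, Set.Finite.coe_toFinset]
    simp only [φ, Function.surjInv_eq hφ, Set.image_id']
  have hspan : Ideal.span G = IsLocalRing.maximalIdeal B := Submodule.span_generators _
  have hscard : s.card = (IsLocalRing.maximalIdeal B).spanFinrank := by
    rw [Finset.card_image_of_injective _ (Function.injective_surjInv hφ),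
      ← Set.ncard_eq_toFinset_card G hGfin, hG, hfg.generators_ncard]
  refine ⟨s, le_antisymm ?_ (sup_le ?_ ?_), ?_⟩
  · intro a ha
    have h1 : φ a ∈ Ideal.map φ (Ideal.span (s : Set A)) := by
      rw [Ideal.map_span, hφs, hspan]
      exact (IsLocalRing.mem_maximalIdeal _).2 fun hu =>
        (IsLocalRing.mem_maximalIdeal a).1 ha (isUnit_of_map_unit φ a hu)
    obtain ⟨b, hb, hab⟩ := (Ideal.mem_map_iff_of_surjective φ hφ).1 h1
    rw [← sub_add_cancel a b]
    refine add_mem (Ideal.mem_sup_left (hker ?_)) (Ideal.mem_sup_right hb)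
    rw [RingHom.mem_ker]
    change φ (a - b) = 0
    rw [map_sub, hab, sub_self]
  · rw [← IsLocalization.AtPrime.map_eq_maximalIdeal y.asIdeal A]
    exact Ideal.map_mono hxy
  · rw [Ideal.span_le]
    intro a ha
    refine (IsLocalRing.mem_maximalIdeal _).2 fun hu => ?_
    have h1 : φ a ∈ IsLocalRing.maximalIdeal B := by
      rw [← hspan, ← hφs]
      exact Ideal.subset_span ⟨a, ha, rfl⟩
    exact (IsLocalRing.mem_maximalIdeal _).1 h1 (hu.map φ)
  · have hdim : (s.card : WithBot ℕ∞) ≤ ringKrullDim B := by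
      rw [hscard, IsRegularLocalRing.spanFinrank_maximalIdeal]
    obtain ⟨t, ht⟩ := Order.le_krullDim_iff.1 hdim
    let ψ : R →+* B := φ.comp (algebraMap R A)
    have hψ : ψ = (algebraMap (R ⧸ x.asIdeal) B).comp (Ideal.Quotient.mk x.asIdeal) := by
      ext r
      exact Localization.localRingHom_to_map _ _ _ hz r
    have hinj : Function.Injective (PrimeSpectrum.comap ψ) := by
      rw [hψ, PrimeSpectrum.comap_comp]
      exact (PrimeSpectrum.comap_injective_of_surjective _ Ideal.Quotient.mk_surjective).comp
        (PrimeSpectrum.localization_comap_injective B z.asIdeal.primeCompl)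
    have hmono : StrictMono (PrimeSpectrum.comap ψ) := fun a b hab =>
      lt_of_le_of_ne (fun c hc => hab.le hc) (hinj.ne hab.ne)
    refine ⟨t.map _ hmono, ?_, ?_, ht⟩
    · intro a ha
      change ψ a ∈ t.head.asIdeal
      have : ψ a = 0 := by
        rw [hψ, RingHom.comp_apply, Ideal.Quotient.eq_zero_iff_mem.2 ha, map_zero]
      rw [this]
      exact t.head.asIdeal.zero_mem
    · intro a ha
      have h1 : ψ a ∈ IsLocalRing.maximalIdeal B :=
        IsLocalRing.le_maximalIdeal t.last.2.ne_top ha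
      rw [hz]
      rw [hψ] at h1
      exact (IsLocalization.AtPrime.to_map_mem_maximal_iff B z.asIdeal _).1 h1

/-- If the maximal ideal `𝔪` of the local ring `A` is `I + (s)`, then the length of
`A/(𝔪^[p^e] + I)` is at most `p^(e * #s)`. -/
theorem length_quotient_map_mk_le {A : Type u} [CommRing A] [IsLocalRing A] (p e : ℕ)
    (I : Ideal A) (s : Finset A)
    (hs : IsLocalRing.maximalIdeal A = I ⊔ Ideal.span (s : Set A)) :
    Module.length (A ⧸ frobeniusPower p (IsLocalRing.maximalIdeal A) e)
      ((A ⧸ frobeniusPower p (IsLocalRing.maximalIdeal A) e) ⧸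
        I.map (Ideal.Quotient.mk (frobeniusPower p (IsLocalRing.maximalIdeal A) e))) ≤
      ((p ^ e) ^ s.card : ℕ) := by
  set J := frobeniusPower p (IsLocalRing.maximalIdeal A) e with hJ
  rw [← Module.length_eq_of_surjective (S := A) (R := A ⧸ J) Ideal.Quotient.mk_surjective]
  have h := length_quotient_sup_span_image_pow_le I s (p ^ e)
  -- `A/(I + (s))` is the residue field, so only the factor `p^e` for each element of `s` remains.
  have h1 : Module.length A (A ⧸ (I ⊔ Ideal.span (s : Set A))) = 1 := by
    rw [← hs, Module.length_eq_one_iff, isSimpleModule_iff_isCoatom]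
    exact (IsLocalRing.maximalIdeal.isMaximal A).out
  rw [h1, mul_one] at h
  refine le_trans ?_ h
  let π : A →ₗ[A] (A ⧸ J) ⧸ I.map (Ideal.Quotient.mk J) :=
    (Ideal.Quotient.mkₐ A (I.map (Ideal.Quotient.mk J))).toLinearMap.comp
      (Ideal.Quotient.mkₐ A J).toLinearMap
  have hπ : ∀ a, π a = Ideal.Quotient.mk (I.map (Ideal.Quotient.mk J)) (Ideal.Quotient.mk J a) :=
    fun _ => rfl
  have hle : I ⊔ Ideal.span ((fun x => x ^ p ^ e) '' (s : Set A)) ≤ LinearMap.ker π := by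
    refine sup_le (fun a ha => ?_) ?_
    · rw [LinearMap.mem_ker, hπ, Ideal.Quotient.eq_zero_iff_mem]
      exact Ideal.mem_map_of_mem _ ha
    · rw [Ideal.span_le]
      rintro _ ⟨a, ha, rfl⟩
      have : a ^ p ^ e ∈ J := pow_mem_frobeniusPower p e
        (hs ▸ Ideal.mem_sup_right (Ideal.subset_span ha))
      rw [SetLike.mem_coe, LinearMap.mem_ker, hπ, Ideal.Quotient.eq_zero_iff_mem.2 this, map_zero]
  refine Module.length_le_of_surjective (Submodule.liftQ _ π hle) fun z => ?_
  obtain ⟨z, rfl⟩ := Ideal.Quotient.mk_surjective z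
  obtain ⟨a, rfl⟩ := Ideal.Quotient.mk_surjective z
  exact ⟨Submodule.Quotient.mk a, rfl⟩

/-- After inverting one element outside `x`, we have
`l(R_y/𝔪_y^[p^e]) ≤ l(R_x/𝔪_x^[p^e]) * p^(e * #s)` whenever the maximal ideal of `R_y` is generated
by `x` and `s`. -/
theorem exists_length_le_mul_pow_card {R : Type u} [CommRing R] [IsNoetherianRing R] (p : ℕ)
    [hp : Fact p.Prime] [Algebra (ZMod p) R] (e : ℕ) (x : PrimeSpectrum R) :
    ∃ g ∉ x.asIdeal, ∀ y : PrimeSpectrum R, x ≤ y → g ∉ y.asIdeal →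
      ∀ s : Finset (Localization.AtPrime y.asIdeal),
        IsLocalRing.maximalIdeal (Localization.AtPrime y.asIdeal) =
          x.asIdeal.map (algebraMap R (Localization.AtPrime y.asIdeal)) ⊔ Ideal.span (s : Set _) →
        Module.length (Localization.AtPrime y.asIdeal) (Localization.AtPrime y.asIdeal ⧸
            frobeniusPower p (IsLocalRing.maximalIdeal (Localization.AtPrime y.asIdeal)) e) ≤
          Module.length (Localization.AtPrime x.asIdeal) (Localization.AtPrime x.asIdeal ⧸
            frobeniusPower p (IsLocalRing.maximalIdeal (Localization.AtPrime x.asIdeal)) e) *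
              ((p ^ e) ^ s.card : ℕ) := by
  have : Nontrivial R := x.nontrivial
  have : ExpChar R p := expChar_of_algebra_zmod p R
  let K := Localization.AtPrime x.asIdeal
  have : ExpChar K p := expChar_of_algebra_zmod p K
  obtain ⟨g, hg, H⟩ := exists_length_quotient_map_le.{u, u, u} x.asIdeal K
    (frobeniusPower p x.asIdeal e) (le_radical_frobeniusPower p x.asIdeal e)
  refine ⟨g, hg, fun y hxy hgy s hs => ?_⟩
  let A := Localization.AtPrime y.asIdeal
  have : ExpChar A p := expChar_of_algebra_zmod p A
  set J := frobeniusPower p (IsLocalRing.maximalIdeal A) e with hJ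
  have hu : IsUnit (algebraMap R (A ⧸ J) g) :=
    (IsLocalization.map_units A (⟨g, hgy⟩ : y.asIdeal.primeCompl)).map (Ideal.Quotient.mk J)
  -- The base change goes to `R_y/𝔪_y^[p^e]` itself: the Frobenius power of `x` vanishes there, so
  -- the left side is the full length at `y`, while `x` still generates a proper quotient controlled
  -- by `s`.
  have h := H (A ⧸ J) hu
  have hmap (I : Ideal R) :
      I.map (algebraMap R (A ⧸ J)) = (I.map (algebraMap R A)).map (Ideal.Quotient.mk J) := by
    rw [Ideal.map_map]; rfl
  have hbot : (frobeniusPower p x.asIdeal e).map (algebraMap R (A ⧸ J)) = ⊥ := by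
    rw [hmap, ← frobeniusPower_map, Ideal.map_eq_bot_iff_le_ker, Ideal.mk_ker, hJ,
      frobeniusPower_eq_map, frobeniusPower_eq_map]
    refine Ideal.map_mono ?_
    rw [← IsLocalization.AtPrime.map_eq_maximalIdeal y.asIdeal A]
    exact Ideal.map_mono hxy
  have h1 : Module.length A (A ⧸ J) = Module.length (A ⧸ J)
      ((A ⧸ J) ⧸ (frobeniusPower p x.asIdeal e).map (algebraMap R (A ⧸ J))) := by
    rw [Module.length_eq_of_surjective (S := A) (R := A ⧸ J) Ideal.Quotient.mk_surjective]
    exact (Submodule.quotEquivOfEqBot _ hbot).symm.length_eq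
  rw [← h1, ← frobeniusPower_map, IsLocalization.AtPrime.map_eq_maximalIdeal x.asIdeal K, hmap] at h
  refine h.trans ?_
  gcongr
  exact length_quotient_map_mk_le p e _ s hs

theorem exists_lamAt_eq {R : Type u} [CommRing R] [IsNoetherianRing R] (p : ℕ)
    [hp : Fact p.Prime] [Algebra (ZMod p) R] (e : ℕ) (x : PrimeSpectrum R)
    (hJ : IsJZero (R ⧸ x.asIdeal)) :
    ∃ g : R, g ∉ x.asIdeal ∧ ∀ y ∈ PrimeSpectrum.zeroLocus (x.asIdeal : Set R) ∩
      (PrimeSpectrum.basicOpen g : Set (PrimeSpectrum R)), lamAt p e R x = lamAt p e R y := by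
  obtain ⟨g₁, hg₁, H₁⟩ := exists_maximalIdeal_eq_sup_span x hJ
  obtain ⟨g₂, hg₂, H₂⟩ := exists_pointHeight_le_add_card x
  obtain ⟨g₃, hg₃, H₃⟩ := exists_length_le_mul_pow_card p e x
  refine ⟨g₁ * g₂ * g₃, fun h => (x.2.mem_or_mem h).elim
    (fun h => (x.2.mem_or_mem h).elim hg₁ hg₂) hg₃, fun y hy => ?_⟩
  have hxy : x ≤ y := hy.1
  have hgy : g₁ * g₂ * g₃ ∉ y.asIdeal := hy.2
  obtain ⟨s, hs, t, ht₁, ht₂, ht₃⟩ := H₁ y hxy fun h =>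
    hgy (Ideal.mul_mem_right _ _ (Ideal.mul_mem_right _ _ h))
  have hle := H₂ y hxy (fun h => hgy (Ideal.mul_mem_right _ _ (Ideal.mul_mem_left _ _ h))) s hs
  have hlen := H₃ y hxy (fun h => hgy (Ideal.mul_mem_left _ _ h)) s hs
  -- The chain has length `#s`, which is also the upper bound for the height difference. Hence `ht y
  -- = ht x + #s`, and the factor `p^(e * #s)` in the length bound cancels against the
  -- normalization.
  obtain ⟨h₁, h₂⟩ := lamAt_le_of_ltSeries p e t ht₁ ht₂ (by omega)
  refine le_antisymm h₁ ?_
  rw [← ENat.natCast_toNat (length_ne_top p e hp.out.ne_zero (Localization.AtPrime x.asIdeal)),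
    ← ENat.natCast_toNat (length_ne_top p e hp.out.ne_zero (Localization.AtPrime y.asIdeal))]
    at hlen
  have hlen' : ((Module.length (Localization.AtPrime y.asIdeal) (Localization.AtPrime y.asIdeal ⧸
      frobeniusPower p (IsLocalRing.maximalIdeal _) e)).toNat : ℝ) ≤
      (Module.length (Localization.AtPrime x.asIdeal) (Localization.AtPrime x.asIdeal ⧸
        frobeniusPower p (IsLocalRing.maximalIdeal _) e)).toNat * ((p : ℝ) ^ e) ^ s.card := by
    exact_mod_cast hlen
  have hp0 : (0 : ℝ) < p := by exact_mod_cast hp.out.pos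
  change _ / (p : ℝ) ^ (e * pointHeight y) ≤ _ / (p : ℝ) ^ (e * pointHeight x)
  rw [div_le_div_iff₀ (by positivity) (by positivity), h₂, ht₃, mul_add, pow_add, mul_comm (_ ^ _),
    ← mul_assoc, pow_mul _ e s.card]
  gcongr

/-! ### Constructibility and semicontinuity -/

open scoped Topology in
-- Every subset of a Noetherian spectrum is quasi-compact, so both `V(x)` and `D(g)` are open in the
-- constructible topology, and `V(x) ∩ D(g)` is a neighbourhood of `x`.
theorem isConstructibleFunction_of_forall_exists {R : Type u} [CommRing R] [IsNoetherianRing R]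
    {α : Type v} (f : PrimeSpectrum R → α)
    (hf : ∀ x : PrimeSpectrum R, ∃ g : R, g ∉ x.asIdeal ∧
      ∀ y ∈ PrimeSpectrum.zeroLocus (x.asIdeal : Set R) ∩
        (PrimeSpectrum.basicOpen g : Set (PrimeSpectrum R)), f x = f y) :
    IsConstructibleFunction f := by
  have hclosed (I : Set R) :
      IsOpen[constructibleTopology (PrimeSpectrum R)] (PrimeSpectrum.zeroLocus I) :=
    (TopologicalSpace.NoetherianSpace.isCompact _).isOpen_constructibleTopology_of_isClosed
      (PrimeSpectrum.isClosed_zeroLocus _)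
  have hopen (g : R) : IsOpen[constructibleTopology (PrimeSpectrum R)]
      (PrimeSpectrum.basicOpen g : Set (PrimeSpectrum R)) :=
    (TopologicalSpace.NoetherianSpace.isCompact _).isOpen_constructibleTopology_of_isOpen
      (PrimeSpectrum.basicOpen g).2
  refine (@IsLocallyConstant.iff_exists_open _ _ (constructibleTopology _) f).2 fun x => ?_
  obtain ⟨g, hg, H⟩ := hf x
  exact ⟨_, @IsOpen.inter _ (constructibleTopology _) _ _ (hclosed x.asIdeal) (hopen g),
    ⟨le_refl x.asIdeal, hg⟩, fun y hy => (H y hy).symm⟩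

theorem upperSemicontinuous_of_monotone {R : Type u} [CommRing R] [IsNoetherianRing R]
    {α : Type v} [LinearOrder α] (f : PrimeSpectrum R → α) (hmono : Monotone f)
    (hf : ∀ x : PrimeSpectrum R, ∃ g : R, g ∉ x.asIdeal ∧
      ∀ y ∈ PrimeSpectrum.zeroLocus (x.asIdeal : Set R) ∩
        (PrimeSpectrum.basicOpen g : Set (PrimeSpectrum R)), f x = f y) :
    UpperSemicontinuous f := by
  rw [upperSemicontinuous_iff_isClosed_preimage]
  intro c
  set Z := f ⁻¹' Set.Ici c with hZ
  refine isClosed_of_closure_subset ?_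
  rw [← PrimeSpectrum.zeroLocus_vanishingIdeal_eq_closure]
  set I := PrimeSpectrum.vanishingIdeal Z with hI
  intro y hy
  -- If `y` lies in the closure of `Z` but not in `Z`, take a minimal prime `x` of the vanishing
  -- ideal below `y`. Monotonicity gives `x ∉ Z`, so `Z` misses `V(x) ∩ D(g)`.
  obtain ⟨P, hP, hPy⟩ := Ideal.exists_minimalPrimes_le (I := I) (J := y.asIdeal) hy
  obtain ⟨x, rfl⟩ : ∃ x : PrimeSpectrum R, x.asIdeal = P := ⟨⟨P, hP.1.1⟩, rfl⟩
  by_contra hyZ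
  have hxZ : x ∉ Z := fun h => hyZ (le_trans (a := c) h (hmono (show x ≤ y from hPy)))
  obtain ⟨g, hg, H⟩ := hf x
  obtain ⟨h, hh, H'⟩ := exists_notMem_forall_mem_of_finite
    (I.finite_minimalPrimes_of_isNoetherianRing.sdiff (t := {x.asIdeal})) x.asIdeal
    (fun J hJ hle => hJ.2 (le_antisymm hle (hP.2 hJ.1.1 hle)))
  -- Each point of `Z` contains either `x`, hence `g`, or another minimal prime of `I`, hence `h`.
  -- So `gh ∈ I ⊆ x`, although neither factor lies in `x`.
  have hmem : g * h ∈ I := by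
    rw [hI, PrimeSpectrum.mem_vanishingIdeal]
    intro z hz
    obtain ⟨P', hP', hPz⟩ := Ideal.exists_minimalPrimes_le (I := I) (J := z.asIdeal) (fun a ha =>
      (PrimeSpectrum.mem_vanishingIdeal Z a).1 ha z hz)
    by_cases hPP : P' = x.asIdeal
    · refine Ideal.mul_mem_right _ _ ?_
      by_contra hgz
      refine hxZ ?_
      rw [hZ, Set.mem_preimage, H z ⟨?_, hgz⟩]
      · exact hz
      · rw [hPP] at hPz
        exact hPz
    · exact Ideal.mul_mem_left _ _ (hPz (H' P' ⟨hP', hPP⟩))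
  exact (x.2.mem_or_mem (hP.1.2 hmem)).elim hg hh

end HilbertKunz

theorem mainTheorem10 (p : ℕ) [Fact p.Prime] (R : Type*) [CommRing R] [IsNoetherianRing R]
    [Algebra (ZMod p) R] (e : ℕ) (he : 1 ≤ e) :
    (∀ x : PrimeSpectrum R, HilbertKunz.IsJZero (R ⧸ x.asIdeal) →
      ∃ g : R, g ∉ x.asIdeal ∧
        ∀ y ∈ PrimeSpectrum.zeroLocus (x.asIdeal : Set R) ∩
            (PrimeSpectrum.basicOpen g : Set (PrimeSpectrum R)),
          HilbertKunz.lamAt p e R x = HilbertKunz.lamAt p e R y) ∧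
    ((∀ x : PrimeSpectrum R, HilbertKunz.IsJZero (R ⧸ x.asIdeal)) →
      HilbertKunz.IsConstructibleFunction (HilbertKunz.lamAt p e R) ∧
      (HilbertKunz.IsCatenaryRing R → HilbertKunz.IsLocallyEquidimensionalRing R →
        UpperSemicontinuous (HilbertKunz.lamAt p e R))) := by
  refine ⟨HilbertKunz.exists_lamAt_eq p e, fun hJ => ⟨?_, fun hcat heq => ?_⟩⟩
  · exact HilbertKunz.isConstructibleFunction_of_forall_exists _ fun x =>
      HilbertKunz.exists_lamAt_eq p e x (hJ x)
  · exact HilbertKunz.upperSemicontinuous_of_monotone _ (HilbertKunz.lamAt_mono p e hcat heq)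
      fun x => HilbertKunz.exists_lamAt_eq p e x (hJ x)
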